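/- Let $M$ be a $\sigma$-compact Hausdorff $C^\infty$ $n$-manifold, possibly with boundary (and neither assumed compact nor connected), and let $1\le r\le\infty$. Groups. A $C^r$ isotopy is a $C^r$ diffeomorphism $F(x,t)=(F_t(x),t)$ of $M\times[0,1]$; it has compact support if $F=\mathrm{id}$ on $(M\setminus K)\times[0,1]$ for some compact $K\subset M$. For $C\subset M$ let $\mathrm{Diff}^r(M,C)_0$ be the group of all $F_1$, where $F$ is a $C^r$ isotopy with $F_0=\mathrm{id}_M$ and $F=\mathrm{id}$ on $U\times[0,1]$ for some neighbourhood $U$ of $C$; let $\mathrm{Diff}^r_c(M,C)_0$ be the group of those $F_1$ for which such an $F$ can be chosen with compact support. For $C=\partial M$ write $\mathrm{Diff}^r(M,\partial)_0$ and $\mathrm{Diff}^r_c(M,\partial)_0$. Norms. For a subset $S$ of a group $G$ and $f\in G$ let $q_{(G,S)}(f)\in\mathbb Z_{\ge0}\cup\{\infty\}$ be the least $k$ such that $f$ is a product of $k$ elements of $S$ ($\infty$ if there is none). For $g\in G$ let $\nu_g=q_{(G,C_g)}$, where $C_g$ is the set of all conjugates in $G$ of $g$ and of $g^{-1}$. For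 $G=\mathrm{Diff}^r(M,\partial)_0$ or $\mathrm{Diff}^r_c(M,\partial)_0$ let $clb^f$ (resp. $clb^d$) be $q_{(G,S)}$ for the set $S$ of those elements of $G$ that are commutators $[a,b]$ with $a,b\in\mathrm{Diff}^r(M,M\setminus\mathrm{Int}_M D)_0$ for some union $D$ of a finite disjoint (resp. discrete in $M$) family of $C^r$ $n$-balls in $\mathrm{Int}\,M$. A $C^r$ $n$-ball in $\mathrm{Int}\,M$ is the image of the closed unit ball of $\mathbb R^n$ under a $C^r$ diffeomorphism from a neighbourhood of it onto an open subset of $\mathrm{Int}\,M$; a family is discrete if every point of $M$ has a neighbourhood meeting at most one member. Let $g\in\mathrm{Diff}^r(M,\partial)_0$ be component-wise non-trivial, i.e. $g|_U\ne\mathrm{id}_U$ for every connected component $U$ of $M$. Then: [I] (i) $\nu_g(f)\le 4\,clb^f(f)$ for all $f$ in $\mathrm{Diff}^r(M,\partial)_0$ (both norms taken in this group). [I] (ii) If $g\in\mathrm{Diff}^r_c(M,\partial)_0$, then $\nu_g(f)\le 4\,clb^f(f)$ for all $f$ in $\mathrm{Diff}^r_c(M,\partial)_0$ (both norms taken in this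 group). [II] Suppose that $g$ is component-wise end-non-trivial, i.e. $g|_U\neq\mathrm{id}_U$ for every compact component $U$ of $M$, and $g|_V\ne\mathrm{id}_V$ for every non-compact component $U$ of $M$, every compact $K\subset U$ and every connected component $V$ of $U\setminus K$ whose closure in $U$ is not compact. Then $\nu_g(f)\le 4\,clb^d(f)$ for all $f$ in $\mathrm{Diff}^r(M,\partial)_0$ (both norms taken in this group). -/

import Mathlib

open scoped Manifold ContDiff Topology

namespace BallNorm

/-! ### Word norms, conjugation-generated norms -/

section WordNorm

variable {G : Type*} [Group G]

/-- The word length `q_{(G,S)}` with respect to a subset `S` of a group: the least `k` such that `g`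
is a product of `k` elements of `S`, and `⊤` if `g` is not a product of elements of `S`. -/
noncomputable def wordNorm (S : Set G) (g : G) : ℕ∞ :=
  sInf {k : ℕ∞ | ∃ l : List G, (∀ s ∈ l, s ∈ S) ∧ l.prod = g ∧ (l.length : ℕ∞) = k}

/-- The conjugation-generated norm `ν_g` of the group `G`: the word length with respect to
the set of all conjugates in `G` of `g` and of `g⁻¹`. -/
noncomputable def conjNorm (g : G) : G → ℕ∞ :=
  wordNorm {x : G | ∃ h : G, x = h * g * h⁻¹ ∨ x = h * g⁻¹ * h⁻¹}

end WordNorm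

/-! ### Topological notions -/

section Topology

variable {X : Type*} [TopologicalSpace X]

/-- The connected components of a subset `A` of a topological space. -/
def components (A : Set X) : Set (Set X) :=
  {V | ∃ x ∈ A, V = connectedComponentIn A x}

/-- A collection of subsets of `X` is discrete if each point has a neighbourhood which meets at most
one member of the collection. -/
def IsDiscreteCollection (𝓕 : Set (Set X)) : Prop :=
  ∀ x : X, ∃ U ∈ 𝓝 x, {B ∈ 𝓕 | (U ∩ B).Nonempty}.Subsingleton

/-- `g` is not the identity on any connected component of `X`. -/
def ComponentwiseNontrivial (g : X → X) : Prop :=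
  ∀ U ∈ components (Set.univ : Set X), ∃ x ∈ U, g x ≠ x

/-- `g` is not the identity on any compact connected component of `X` and, for each noncompact
component `U` and each compact `K ⊆ U`, it is not the identity on any connected component of `U \ K`
with noncompact closure. (Components `U` are closed, so closures in `U` and in `X` agree.) -/
def ComponentwiseEndNontrivial (g : X → X) : Prop :=
  (∀ U ∈ components (Set.univ : Set X), IsCompact U → ∃ x ∈ U, g x ≠ x) ∧
  (∀ U ∈ components (Set.univ : Set X), ¬ IsCompact U →
    ∀ K : Set X, K ⊆ U → IsCompact K →
      ∀ V ∈ components (U \ K), ¬ IsCompact (closure V) → ∃ x ∈ V, g x ≠ x)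

end Topology

/-! ### Manifolds possibly with boundary, diffeomorphism groups, isotopies -/

section Manifold

variable {n : ℕ} {H : Type*} [TopologicalSpace H]

/-- The model is the Euclidean space `ℝⁿ` or a closed half-space of it: manifolds over such a model
are the `n`-manifolds possibly with boundary (and without corners). In particular `𝓡 n` and,
for `n ≠ 0`, `𝓡∂ n` are such models. -/
def IsBoundaryModel (I : ModelWithCorners ℝ (EuclideanSpace ℝ (Fin n)) H) : Prop :=
  Set.range I = Set.univ ∨ ∃ i : Fin n, Set.range I = {x | 0 ≤ x i}

variable (I : ModelWithCorners ℝ (EuclideanSpace ℝ (Fin n)) H)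
  {M : Type*} [TopologicalSpace M] [ChartedSpace H M] (r : WithTop ℕ∞)

/-- The group `Diff^r(M)` under composition. -/
noncomputable instance diffeoGroup : Group (M ≃ₘ^r⟮I, I⟯ M) where
  mul f g := g.trans f
  one := Diffeomorph.refl I M r
  inv f := f.symm
  mul_assoc _ _ _ := rfl
  one_mul _ := rfl
  mul_one _ := rfl
  inv_mul_cancel f := f.self_trans_symm

/-- `C^r` diffeomorphisms of `M × [0,1]`. -/
abbrev CylDiffeo (M : Type*) [TopologicalSpace M] [ChartedSpace H M] : Type _ :=
  (M × Set.Icc (0 : ℝ) 1) ≃ₘ^r⟮I.prod (𝓡∂ 1), I.prod (𝓡∂ 1)⟯ (M × Set.Icc (0 : ℝ) 1)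

variable {I r}

/-- A `C^r` isotopy: a `C^r` diffeomorphism of `M × [0,1]` which preserves the `[0,1]`-factor. -/
def IsIsotopy (F : CylDiffeo I r M) : Prop := ∀ p, (F p).2 = p.2

/-- `F ∈ Isot^r(M; C)_0`: an isotopy with `F_0 = id` which is the identity on `U × [0,1]` for some
neighbourhood `U` of `C`. -/
def IsIsotopyRel (C : Set M) (F : CylDiffeo I r M) : Prop :=
  IsIsotopy F ∧ (∀ x, F (x, 0) = (x, 0)) ∧ ∃ U ∈ 𝓝ˢ C, ∀ x ∈ U, ∀ t, F (x, t) = (x, t)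

/-- `F` has compact support: it is the identity on `(M \ K) × [0,1]` for some compact `K`. -/
def HasCompactSupp (F : CylDiffeo I r M) : Prop :=
  ∃ K : Set M, IsCompact K ∧ ∀ x ∉ K, ∀ t, F (x, t) = (x, t)

/-- `F_1 = f`. -/
def EndsAt (F : CylDiffeo I r M) (f : M ≃ₘ^r⟮I, I⟯ M) : Prop := ∀ x, F (x, 1) = (f x, 1)

theorem IsIsotopyRel.refl (C : Set M) :
    IsIsotopyRel C (Diffeomorph.refl (I.prod (𝓡∂ 1)) (M × Set.Icc (0 : ℝ) 1) r) :=
  ⟨fun _ => rfl, fun _ => rfl, Set.univ, Filter.univ_mem, fun _ _ _ => rfl⟩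

theorem IsIsotopyRel.trans {C : Set M} {F F' : CylDiffeo I r M} (h : IsIsotopyRel C F)
    (h' : IsIsotopyRel C F') : IsIsotopyRel C (F'.trans F) := by
  obtain ⟨h1, h2, U, hU, h3⟩ := h
  obtain ⟨h1', h2', U', hU', h3'⟩ := h'
  refine ⟨fun p => ?_, fun x => ?_, U ∩ U', Filter.inter_mem hU hU', fun x hx t => ?_⟩
  · change (F (F' p)).2 = p.2
    rw [h1, h1']
  · change F (F' (x, 0)) = (x, 0)
    rw [h2', h2]
  · change F (F' (x, t)) = (x, t)
    rw [h3' x hx.2, h3 x hx.1]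

theorem symm_eq_of_eq {F : CylDiffeo I r M} {p q : M × Set.Icc (0 : ℝ) 1} (h : F p = q) :
    F.symm q = p := by
  rw [← h, F.symm_apply_apply]

theorem IsIsotopyRel.symm {C : Set M} {F : CylDiffeo I r M} (h : IsIsotopyRel C F) :
    IsIsotopyRel C F.symm := by
  obtain ⟨h1, h2, U, hU, h3⟩ := h
  refine ⟨fun p => ?_, fun x => symm_eq_of_eq (h2 x), U, hU,
    fun x hx t => symm_eq_of_eq (h3 x hx t)⟩
  have := h1 (F.symm p)
  rw [F.apply_symm_apply] at this
  exact this.symm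

theorem HasCompactSupp.trans {F F' : CylDiffeo I r M} (h : HasCompactSupp F)
    (h' : HasCompactSupp F') : HasCompactSupp (F'.trans F) := by
  obtain ⟨K, hK, h1⟩ := h
  obtain ⟨K', hK', h1'⟩ := h'
  refine ⟨K ∪ K', hK.union hK', fun x hx t => ?_⟩
  change F (F' (x, t)) = (x, t)
  rw [h1' x (fun h => hx (Or.inr h)), h1 x (fun h => hx (Or.inl h))]

theorem HasCompactSupp.symm {F : CylDiffeo I r M} (h : HasCompactSupp F) :
    HasCompactSupp F.symm := by
  obtain ⟨K, hK, h1⟩ := h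
  exact ⟨K, hK, fun x hx t => symm_eq_of_eq (h1 x hx t)⟩

theorem EndsAt.trans {F F' : CylDiffeo I r M} {f f' : M ≃ₘ^r⟮I, I⟯ M} (h : EndsAt F f)
    (h' : EndsAt F' f') : EndsAt (F'.trans F) (f * f') := by
  intro x
  change F (F' (x, 1)) = (f (f' x), 1)
  rw [h', h]

theorem EndsAt.symm {F : CylDiffeo I r M} {f : M ≃ₘ^r⟮I, I⟯ M} (h : EndsAt F f) :
    EndsAt F.symm f⁻¹ := by
  intro x
  refine symm_eq_of_eq ?_
  rw [h]
  change (f (f.symm x), _) = _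
  rw [f.apply_symm_apply]

variable (I r)

/-- The group `Diff^r(M; C)_0` of the end diffeomorphisms `F_1` of isotopies
`F ∈ Isot^r(M; C)_0`. -/
def DiffZero (C : Set M) : Subgroup (M ≃ₘ^r⟮I, I⟯ M) where
  carrier := {f | ∃ F : CylDiffeo I r M, IsIsotopyRel C F ∧ EndsAt F f}
  mul_mem' := fun ⟨_, h1, h2⟩ ⟨_, h1', h2'⟩ => ⟨_, h1.trans h1', h2.trans h2'⟩
  one_mem' := ⟨_, IsIsotopyRel.refl C, fun _ => rfl⟩
  inv_mem' := fun ⟨_, h1, h2⟩ => ⟨_, h1.symm, h2.symm⟩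

/-- The group `Diff^r_c(M; C)_0` of the end diffeomorphisms `F_1` of isotopies
`F ∈ Isot^r(M; C)_0` with compact support. -/
def DiffCompactZero (C : Set M) : Subgroup (M ≃ₘ^r⟮I, I⟯ M) where
  carrier := {f | ∃ F : CylDiffeo I r M, IsIsotopyRel C F ∧ HasCompactSupp F ∧ EndsAt F f}
  mul_mem' := fun ⟨_, h1, h2, h3⟩ ⟨_, h1', h2', h3'⟩ =>
    ⟨_, h1.trans h1', h2.trans h2', h3.trans h3'⟩
  one_mem' := ⟨_, IsIsotopyRel.refl C, ⟨∅, isCompact_empty, fun _ _ _ => rfl⟩, fun _ => rfl⟩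
  inv_mem' := fun ⟨_, h1, h2, h3⟩ => ⟨_, h1.symm, h2.symm, h3.symm⟩

/-! ### Balls and commutator lengths supported in balls -/

/-- `D` is a `C^r` `n`-ball in the interior of `M`: the image of the closed unit ball of `ℝⁿ` under
a `C^r` diffeomorphism from an open neighbourhood of it onto an open subset of the interior. -/
def IsBall (D : Set M) : Prop :=
  ∃ φ : OpenPartialHomeomorph (EuclideanSpace ℝ (Fin n)) M,
    ContMDiffOn (𝓡 n) I r φ φ.source ∧ ContMDiffOn I (𝓡 n) r φ.symm φ.target ∧
    Metric.closedBall 0 1 ⊆ φ.source ∧ φ.target ⊆ I.interior M ∧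
    D = φ '' Metric.closedBall 0 1

/-- The finite disjoint unions of `C^r` `n`-balls in the interior of `M`. -/
def finiteBallUnions (M : Type*) [TopologicalSpace M] [ChartedSpace H M] : Set (Set M) :=
  {D | ∃ 𝓕 : Set (Set M), (∀ B ∈ 𝓕, IsBall I r B) ∧ 𝓕.Finite ∧ 𝓕.PairwiseDisjoint id ∧
    D = ⋃₀ 𝓕}

/-- The unions of families of `C^r` `n`-balls in the interior of `M` which are discrete in `M`. -/
def discreteBallUnions (M : Type*) [TopologicalSpace M] [ChartedSpace H M] : Set (Set M) :=
  {D | ∃ 𝓕 : Set (Set M), (∀ B ∈ 𝓕, IsBall I r B) ∧ IsDiscreteCollection 𝓕 ∧ D = ⋃₀ 𝓕}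

variable {I r}

/-- The elements of `G` which are, for some `D ∈ 𝓑`, commutators `a b a⁻¹ b⁻¹` of two elements
of the group `Diff^r(M, M_D)_0`, where `M_D` is the complement of the interior of `D`. -/
def ballCommutators (G : Subgroup (M ≃ₘ^r⟮I, I⟯ M)) (𝓑 : Set (Set M)) : Set G :=
  {f | ∃ D ∈ 𝓑, ∃ a ∈ DiffZero I r (interior D)ᶜ, ∃ b ∈ DiffZero I r (interior D)ᶜ,
    (f : M ≃ₘ^r⟮I, I⟯ M) = a * b * a⁻¹ * b⁻¹}

/-- `clb^f` on `G`: the commutator length supported in finite disjoint unions of balls. -/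
noncomputable def clbf (G : Subgroup (M ≃ₘ^r⟮I, I⟯ M)) : G → ℕ∞ :=
  wordNorm (ballCommutators G (finiteBallUnions I r M))

/-- `clb^d` on `G`: the commutator length supported in discrete unions of balls. -/
noncomputable def clbd (G : Subgroup (M ≃ₘ^r⟮I, I⟯ M)) : G → ℕ∞ :=
  wordNorm (ballCommutators G (discreteBallUnions I r M))

end Manifold

end BallNorm

/-!
The norms `clbf` and `clbd` count commutators `[a, b]` of diffeomorphisms supported in a union `D` of
disjoint balls, so it is enough to write each such commutator as a product of four conjugates of
`g` and `g⁻¹`. If a conjugate `γ` of `g` moves the union of the supports of `a` and `b` off itself, then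
`γ a⁻¹ γ⁻¹` commutes with `b`, so that `[a, b] = [[a, γ], b]`, and expanding the right-hand side gives
four conjugates of `γ` and `γ⁻¹` (`exists_conj_list_of_commute`). Hence everything rests on finding
an element `h` of the group such that `g` displaces the image under `h` of the supports of `a` and
`b` (`exists_displacement_of_balls`).

Since `a` and `b` are the identity near the complement of the interior of `D`, their supports meet
each ball in a compact subset of its interior, and can be shrunk towards the centre inside the ball.
It remains to move the set `P` of the centres, which is locally finite in `M`, into an open set `V`
with `g V ∩ V = ∅` (`exists_displaced_open`). To this end `P` is covered by a locally finite family of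
disjoint connected open sets, the pieces, each containing finitely many points of `P` and some point
moved by `g`. In each piece choose an interior point moved by `g`, such that `g` maps no chosen point
to a chosen point; then the set of chosen points has a neighbourhood `V` displaced by `g`, and in
each piece separately the finitely many points of `P` are moved into `V` (`exists_move_finite`). The
isotopies have disjoint, locally finite supports and are performed simultaneously.

For finitely many balls, the pieces are connected components of `M`. For infinitely many balls in a
noncompact component, they are constructed along an exhaustion by compact sets whose complement has
no relatively compact components (`exists_fill_extension`); it is here that `g` must be nontrivial
near every end. The isotopies themselves are all composed of one explicit contraction
`x ↦ x + s χ(x) (y - x)` in a coordinate ball (`isCell_image_ball`).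
-/

namespace BallNorm

/-! ### Word norms and commutators -/

section Words

variable {G : Type*} [Group G]

theorem exists_list_of_wordNorm_ne_top {S : Set G} {f : G} (h : wordNorm S f ≠ ⊤) :
    ∃ l : List G, (∀ s ∈ l, s ∈ S) ∧ l.prod = f ∧ (l.length : ℕ∞) = wordNorm S f := by
  have hne : {k : ℕ∞ | ∃ l : List G, (∀ s ∈ l, s ∈ S) ∧ l.prod = f ∧
      (l.length : ℕ∞) = k}.Nonempty := by
    by_contra hne
    rw [Set.not_nonempty_iff_eq_empty] at hne
    exact h (by rw [wordNorm, hne, sInf_empty])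
  exact csInf_mem hne

theorem wordNorm_le_length {S : Set G} (l : List G) (h : ∀ s ∈ l, s ∈ S) :
    wordNorm S l.prod ≤ l.length :=
  sInf_le ⟨l, h, rfl, rfl⟩

theorem wordNorm_le_mul {S T : Set G} {k : ℕ} (hk : k ≠ 0)
    (h : ∀ t ∈ T, ∃ l : List G, (∀ s ∈ l, s ∈ S) ∧ l.prod = t ∧ l.length = k) (f : G) :
    wordNorm S f ≤ k * wordNorm T f := by
  by_cases htop : wordNorm T f = ⊤
  · rw [htop, ENat.mul_top (by exact_mod_cast hk)]
    exact le_top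
  obtain ⟨l, hl, rfl, hlen⟩ := exists_list_of_wordNorm_ne_top htop
  rw [← hlen]
  clear hlen htop
  suffices H : ∃ m : List G, (∀ s ∈ m, s ∈ S) ∧ m.prod = l.prod ∧ m.length = k * l.length by
    obtain ⟨m, hm, hprod, hmlen⟩ := H
    rw [← hprod]
    refine (wordNorm_le_length m hm).trans ?_
    rw [hmlen]
    push_cast
    exact le_rfl
  induction l with
  | nil => exact ⟨[], by simp, rfl, by simp⟩
  | cons t l ih =>
    obtain ⟨m, hm, hprod, hmlen⟩ := ih fun s hs => hl s (List.mem_cons_of_mem _ hs)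
    obtain ⟨m', hm', hprod', hmlen'⟩ := h t (hl t List.mem_cons_self)
    refine ⟨m' ++ m, fun s hs => ?_, ?_, ?_⟩
    · rcases List.mem_append.1 hs with hs | hs
      exacts [hm' s hs, hm s hs]
    · rw [List.prod_append, hprod, hprod', List.prod_cons]
    · rw [List.length_append, hmlen, hmlen', List.length_cons]
      ring

/-- If the conjugate `γ = h g h⁻¹` pushes `a` to an element commuting with `b`, then
`[a, b] = [[a, γ], b]`, and the right-hand side is a product of four conjugates of `g` and
`g⁻¹`. -/
theorem exists_conj_list_of_commute {g h a b : G}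
    (hc : Commute ((h * g * h⁻¹) * a⁻¹ * (h * g * h⁻¹)⁻¹) b) :
    ∃ l : List G, (∀ s ∈ l, s ∈ {x : G | ∃ h : G, x = h * g * h⁻¹ ∨ x = h * g⁻¹ * h⁻¹}) ∧
      l.prod = a * b * a⁻¹ * b⁻¹ ∧ l.length = 4 := by
  refine ⟨[(a * h) * g * (a * h)⁻¹, h * g⁻¹ * h⁻¹, (b * h) * g * (b * h)⁻¹,
    (b * a * h) * g⁻¹ * (b * a * h)⁻¹], ?_, ?_, rfl⟩
  · intro s hs
    simp only [List.mem_cons, List.not_mem_nil, or_false] at hs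
    rcases hs with rfl | rfl | rfl | rfl
    exacts [⟨_, Or.inl rfl⟩, ⟨_, Or.inr rfl⟩, ⟨_, Or.inl rfl⟩, ⟨_, Or.inr rfl⟩]
  · generalize hγ : h * g * h⁻¹ = γ at hc
    have h1 : (a * h) * g * (a * h)⁻¹ = a * γ * a⁻¹ := by rw [← hγ]; group
    have h2 : h * g⁻¹ * h⁻¹ = γ⁻¹ := by rw [← hγ]; group
    have h3 : (b * h) * g * (b * h)⁻¹ = b * γ * b⁻¹ := by rw [← hγ]; group
    have h4 : (b * a * h) * g⁻¹ * (b * a * h)⁻¹ = b * a * γ⁻¹ * a⁻¹ * b⁻¹ := by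
      rw [← hγ]; group
    rw [h1, h2, h3, h4]
    simp only [List.prod_cons, List.prod_nil]
    calc _ = a * ((γ * a⁻¹ * γ⁻¹) * b) * (γ * a * γ⁻¹ * a⁻¹ * b⁻¹) := by group
      _ = a * (b * (γ * a⁻¹ * γ⁻¹)) * (γ * a * γ⁻¹ * a⁻¹ * b⁻¹) := by rw [hc.eq]
      _ = _ := by group

end Words

/-! ### Filled compact sets and pieces -/

section Filling

variable {X : Type*} [TopologicalSpace X]

theorem exists_relatively_compact_preconnected [LocallyConnectedSpace X]
    [LocallyCompactSpace X] [T2Space X] {Ω : Set X} (hΩ : IsOpen Ω) (hc : IsPreconnected Ω)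
    {x y : X} (hx : x ∈ Ω) (hy : y ∈ Ω) :
    ∃ G : Set X, IsOpen G ∧ IsPreconnected G ∧ IsCompact (closure G) ∧ closure G ⊆ Ω ∧
      x ∈ G ∧ y ∈ G := by
  refine hc.induction₂ (fun x y => ∃ G : Set X, IsOpen G ∧ IsPreconnected G ∧
    IsCompact (closure G) ∧ closure G ⊆ Ω ∧ x ∈ G ∧ y ∈ G) ?_ ?_ ?_ hx hy
  · intro x hx
    obtain ⟨V, hVo, hxV, hVΩ, hVc⟩ := exists_open_between_and_isCompact_closure
      (isCompact_singleton (x := x)) hΩ (by simpa using hx)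
    have hxV' : x ∈ V := hxV rfl
    have hsub : closure (connectedComponentIn V x) ⊆ closure V :=
      closure_mono (connectedComponentIn_subset V x)
    filter_upwards [mem_nhdsWithin_of_mem_nhds
      ((hVo.connectedComponentIn (x := x)).mem_nhds (mem_connectedComponentIn hxV'))] with y hy
    exact ⟨connectedComponentIn V x, hVo.connectedComponentIn,
      isPreconnected_connectedComponentIn, hVc.of_isClosed_subset isClosed_closure hsub,
      hsub.trans hVΩ, mem_connectedComponentIn hxV', hy⟩
  · rintro x y z - - - ⟨G, h1, h2, h3, h4, h5, h6⟩ ⟨G', h1', h2', h3', h4', h5', h6'⟩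
    refine ⟨G ∪ G', h1.union h1', h2.union y h6 h5' h2', ?_, ?_, Or.inl h5, Or.inr h6'⟩
    · rw [closure_union]; exact h3.union h3'
    · rw [closure_union]; exact Set.union_subset h4 h4'
  · rintro x y - - ⟨G, h1, h2, h3, h4, h5, h6⟩
    exact ⟨G, h1, h2, h3, h4, h6, h5⟩

/-- The union of `C` with the components of its complement whose closure is compact. (For `x ∈ C`
the set `connectedComponentIn Cᶜ x` is empty.) -/
def fill (C : Set X) : Set X := {x | IsCompact (closure (connectedComponentIn Cᶜ x))}

theorem subset_fill (C : Set X) : C ⊆ fill C := by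
  intro x hx
  rw [fill, Set.mem_ofPred_eq, connectedComponentIn_eq_empty (by simpa using hx), closure_empty]
  exact isCompact_empty

theorem fill_mono {C D : Set X} (h : C ⊆ D) : fill C ⊆ fill D := fun x hx =>
  IsCompact.of_isClosed_subset hx isClosed_closure
    (closure_mono (connectedComponentIn_mono x (Set.compl_subset_compl.2 h)))

theorem mem_fill_iff_of_mem_component {C : Set X} {x y : X}
    (hy : y ∈ connectedComponentIn Cᶜ x) : y ∈ fill C ↔ x ∈ fill C := by
  rw [fill, Set.mem_ofPred_eq, Set.mem_ofPred_eq, connectedComponentIn_eq hy]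

theorem fill_fill_subset (C : Set X) : fill (fill C) ⊆ fill C := by
  intro x hx
  by_contra hxC
  have hxC' : x ∈ Cᶜ := fun h => hxC (subset_fill C h)
  refine hxC (IsCompact.of_isClosed_subset hx isClosed_closure (closure_mono ?_))
  refine isPreconnected_connectedComponentIn.subset_connectedComponentIn
    (mem_connectedComponentIn hxC') fun y hy hyC => hxC ?_
  exact (mem_fill_iff_of_mem_component hy).1 hyC

/-- A locally finite family `𝒪` of disjoint connected open sets covering `P`, each of which
contains finitely many points of `P`, but at least one, and meets `S`. -/
structure IsPieceFamily (P S : Set X) (𝒪 : Set (Set X)) : Prop where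
  isOpen : ∀ O ∈ 𝒪, IsOpen O
  isPreconnected : ∀ O ∈ 𝒪, IsPreconnected O
  pairwiseDisjoint : 𝒪.PairwiseDisjoint id
  locallyFinite : ∀ x : X, ∃ U ∈ 𝓝 x, {O ∈ 𝒪 | (O ∩ U).Nonempty}.Finite
  subset_sUnion : P ⊆ ⋃₀ 𝒪
  inter_nonempty : ∀ O ∈ 𝒪, (P ∩ O).Nonempty
  inter_finite : ∀ O ∈ 𝒪, (P ∩ O).Finite
  meets : ∀ O ∈ 𝒪, (O ∩ S).Nonempty

theorem IsPieceFamily.finite {P S : Set X} {𝒪 : Set (Set X)} (h : IsPieceFamily P S 𝒪)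
    (hP : P.Finite) : 𝒪.Finite := by
  have key : ∀ O ∈ 𝒪, ∃ p, p ∈ P ∩ O := h.inter_nonempty
  choose p hp using key
  have hinj : Function.Injective fun O : 𝒪 => (⟨p O.1 O.2, (hp O.1 O.2).1⟩ : P) := fun O O' heq =>
    Subtype.ext (h.pairwiseDisjoint.elim_set O.2 O'.2 _ (hp O.1 O.2).2
      (Subtype.mk.inj heq ▸ (hp O'.1 O'.2).2))
  have := hP.to_subtype
  exact Set.finite_coe_iff.1 (Finite.of_injective _ hinj)

theorem isClosed_of_mem_components_univ {U : Set X}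
    (hU : U ∈ components (Set.univ : Set X)) : IsClosed U := by
  obtain ⟨x, -, rfl⟩ := hU
  rw [connectedComponentIn_univ]
  exact isClosed_connectedComponent

theorem isPreconnected_of_mem_components_univ {U : Set X}
    (hU : U ∈ components (Set.univ : Set X)) : IsPreconnected U := by
  obtain ⟨x, -, rfl⟩ := hU
  exact isPreconnected_connectedComponentIn

theorem eq_of_mem_components_univ {U V : Set X} (hU : U ∈ components (Set.univ : Set X))
    (hV : V ∈ components (Set.univ : Set X)) {x : X} (hxU : x ∈ U) (hxV : x ∈ V) : U = V := by
  obtain ⟨y, -, rfl⟩ := hU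
  obtain ⟨z, -, rfl⟩ := hV
  rw [connectedComponentIn_eq hxU, connectedComponentIn_eq hxV]

theorem isPieceFamily_singleton {P S U : Set X} (hU : IsOpen U) (hc : IsPreconnected U)
    (hne : (P ∩ U).Nonempty) (hfin : (P ∩ U).Finite) (hS : (U ∩ S).Nonempty) :
    IsPieceFamily (P ∩ U) S {U} := by
  have hPU : P ∩ U ∩ U = P ∩ U := by rw [Set.inter_assoc, Set.inter_self]
  refine ⟨?_, ?_, Set.pairwiseDisjoint_singleton _ _, fun x => ⟨Set.univ, Filter.univ_mem,
    (Set.finite_singleton U).subset fun O hO => hO.1⟩, ?_, ?_, ?_, ?_⟩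
  · rintro O rfl; exact hU
  · rintro O rfl; exact hc
  · rw [Set.sUnion_singleton]; exact Set.inter_subset_right
  · rintro O rfl; rwa [hPU]
  · rintro O rfl; rwa [hPU]
  · rintro O rfl; exact hS

variable [LocallyConnectedSpace X]

theorem isClosed_fill {C : Set X} (hC : IsClosed C) : IsClosed (fill C) := by
  rw [← isOpen_compl_iff, isOpen_iff_mem_nhds]
  intro x hx
  have hxC' : x ∈ Cᶜ := fun h => hx (subset_fill C h)
  refine Filter.mem_of_superset ((hC.isOpen_compl.connectedComponentIn (x := x)).mem_nhds
    (mem_connectedComponentIn hxC')) fun y hy hyC => hx ?_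
  exact (mem_fill_iff_of_mem_component hy).1 hyC

theorem isOpen_fill_diff {C : Set X} (hC : IsClosed C) : IsOpen (fill C \ C) := by
  rw [isOpen_iff_mem_nhds]
  rintro x ⟨hx, hxC⟩
  refine Filter.mem_of_superset ((hC.isOpen_compl.connectedComponentIn (x := x)).mem_nhds
    (mem_connectedComponentIn hxC)) fun y hy => ⟨?_, connectedComponentIn_subset _ _ hy⟩
  exact (mem_fill_iff_of_mem_component hy).2 hx

/-- If `W` is a component of the complement of a closed set `C`, and `V` is a preconnected set
meeting `W`, then `V ⊆ W` unless `V` meets `C` in a point of the closure of `W`. -/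
theorem subset_component_of_disjoint_closure {C V : Set X} (hC : IsClosed C)
    (hV : IsPreconnected V) {x : X} (hx : x ∈ V) (hxC : x ∉ C)
    (h : ∀ y ∈ V, y ∈ C → y ∉ closure (connectedComponentIn Cᶜ x)) :
    V ⊆ connectedComponentIn Cᶜ x := by
  refine hV.subset_of_closure_inter_subset hC.isOpen_compl.connectedComponentIn
    ⟨x, hx, mem_connectedComponentIn hxC⟩ ?_
  rintro y ⟨hy, hyV⟩
  have hyC : y ∈ Cᶜ := fun hyC => h y hyV hyC hy
  obtain ⟨z, hzy, hzx⟩ := mem_closure_iff.1 hy _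
    (hC.isOpen_compl.connectedComponentIn (x := y)) (mem_connectedComponentIn hyC)
  rw [connectedComponentIn_eq hzx, ← connectedComponentIn_eq hzy]
  exact mem_connectedComponentIn hyC

theorem isCompact_fill [LocallyCompactSpace X] [T2Space X] [PreconnectedSpace X]
    [NoncompactSpace X] {C : Set X} (hC : IsCompact C) : IsCompact (fill C) := by
  obtain ⟨L, hL, hCL⟩ := exists_compact_superset hC
  have hfr : IsCompact (frontier L) :=
    hL.of_isClosed_subset isClosed_frontier hL.isClosed.frontier_subset
  have hfrC : ∀ y ∈ frontier L, y ∈ Cᶜ := fun y hy hyC => hy.2 (hCL hyC)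
  obtain ⟨t, -, htcov⟩ := hfr.elim_nhds_subcover (fun y => connectedComponentIn Cᶜ y)
    fun y hy => (hC.isClosed.isOpen_compl.connectedComponentIn).mem_nhds
      (mem_connectedComponentIn (hfrC y hy))
  classical
  have hcomp : IsCompact (L ∪ ⋃ y ∈ t.filter (fun y => y ∈ fill C),
      closure (connectedComponentIn Cᶜ y)) :=
    hL.union (Finset.isCompact_biUnion _ fun y hy => (Finset.mem_filter.1 hy).2)
  refine hcomp.of_isClosed_subset (isClosed_fill hC.isClosed) fun x hx => ?_
  by_cases hxL : x ∈ L
  · exact Or.inl hxL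
  have hxC : x ∉ C := fun h => hxL (interior_subset (hCL h))
  right
  by_cases hmeet : (connectedComponentIn Cᶜ x ∩ frontier L).Nonempty
  · obtain ⟨z, hzx, hzL⟩ := hmeet
    obtain ⟨y, hyt, hzy⟩ := Set.mem_iUnion₂.1 (htcov hzL)
    have hxy : x ∈ connectedComponentIn Cᶜ y := by
      rw [connectedComponentIn_eq hzy, ← connectedComponentIn_eq hzx]
      exact mem_connectedComponentIn hxC
    exact Set.mem_iUnion₂.2 ⟨y, Finset.mem_filter.2
      ⟨hyt, (mem_fill_iff_of_mem_component hxy).1 hx⟩, subset_closure hxy⟩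
  · exfalso
    have hsub : connectedComponentIn Cᶜ x ⊆ Lᶜ := by
      refine isPreconnected_connectedComponentIn.subset_of_closure_inter_subset
        hL.isClosed.isOpen_compl ⟨x, mem_connectedComponentIn hxC, hxL⟩ ?_
      rintro y ⟨hy, hyx⟩ hyL
      rw [closure_compl] at hy
      exact hmeet ⟨y, hyx, subset_closure hyL, hy⟩
    have huniv : Set.univ ⊆ connectedComponentIn Cᶜ x := by
      refine subset_component_of_disjoint_closure hC.isClosed isPreconnected_univ
        (Set.mem_univ x) hxC fun y _ hyC hy => ?_
      have := closure_mono hsub hy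
      rw [closure_compl] at this
      exact this (hCL hyC)
    refine noncompact_univ X (IsCompact.of_isClosed_subset hx isClosed_univ ?_)
    exact huniv.trans subset_closure

/-- A finite set `F` of points each of whose components in the open set `Ω` meets `S` can be covered by a
relatively compact open subset of `Ω` all of whose components meet `S`. -/
theorem exists_relatively_compact_components_meet [LocallyCompactSpace X] [T2Space X]
    {S Ω F : Set X} (hΩ : IsOpen Ω) (hF : F.Finite) (hFΩ : F ⊆ Ω)
    (hS : ∀ x ∈ F, (connectedComponentIn Ω x ∩ S).Nonempty) :
    ∃ R : Set X, IsOpen R ∧ F ⊆ R ∧ IsCompact (closure R) ∧ closure R ⊆ Ω ∧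
      ∀ x ∈ R, (connectedComponentIn R x ∩ S).Nonempty := by
  have key : ∀ x ∈ F, ∃ G : Set X, IsOpen G ∧ IsPreconnected G ∧ IsCompact (closure G) ∧
      closure G ⊆ Ω ∧ x ∈ G ∧ (G ∩ S).Nonempty := by
    intro x hx
    obtain ⟨s, hs, hsS⟩ := hS x hx
    obtain ⟨G, h1, h2, h3, h4, h5, h6⟩ := exists_relatively_compact_preconnected
      (hΩ.connectedComponentIn (x := x)) isPreconnected_connectedComponentIn
      (mem_connectedComponentIn (hFΩ hx)) hs
    exact ⟨G, h1, h2, h3, h4.trans (connectedComponentIn_subset _ _), h5, s, h6, hsS⟩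
  choose! G h1 h2 h3 h4 h5 h6 using key
  refine ⟨⋃ x ∈ F, G x, isOpen_biUnion h1, fun x hx => Set.mem_biUnion hx (h5 x hx), ?_, ?_, ?_⟩
  · rw [hF.closure_biUnion]
    exact hF.isCompact_biUnion h3
  · rw [hF.closure_biUnion]
    exact Set.iUnion₂_subset h4
  · intro y hy
    obtain ⟨x, hx, hyx⟩ := Set.mem_iUnion₂.1 hy
    refine (h6 x hx).mono (Set.inter_subset_inter_left _ ?_)
    exact (h2 x hx).subset_connectedComponentIn hyx (Set.subset_biUnion_of_mem hx)

/-- One step of the construction of pieces: given a compact set `Z` without relatively compact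
complementary components, the next compact set `Z'` of this kind is chosen so that the points of
`P` in `Z' \ Z` can be joined to `S` inside an open subset of `Z' \ Z`. -/
theorem exists_fill_extension [LocallyCompactSpace X] [T2Space X] [PreconnectedSpace X]
    [NoncompactSpace X] {P S Z K : Set X}
    (hP : ∀ C : Set X, IsCompact C → (P ∩ C).Finite)
    (hS : ∀ C : Set X, IsCompact C → ∀ x ∉ fill C, (connectedComponentIn Cᶜ x ∩ S).Nonempty)
    (hZ : IsCompact Z) (hZf : fill Z ⊆ Z) (hK : IsCompact K) :
    ∃ Z' O : Set X, IsCompact Z' ∧ fill Z' ⊆ Z' ∧ Z ∪ K ⊆ Z' ∧ IsOpen O ∧ O ⊆ Z' \ Z ∧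
      P ∩ (Z' \ Z) ⊆ O ∧ ∀ x ∈ O, (connectedComponentIn O x ∩ S).Nonempty := by
  set C := fill (Z ∪ K) with hCdef
  have hC : IsCompact C := isCompact_fill (hZ.union hK)
  have hZC : Z ∪ K ⊆ C := subset_fill _
  have hCf : fill C ⊆ C := fill_fill_subset _
  set F := P ∩ (C \ Z) with hFdef
  have hF : F.Finite := (hP C hC).subset fun x hx => ⟨hx.1, hx.2.1⟩
  -- Among the admissible neighbourhoods `R` of `F`, one minimizes the number of points of `P` in
  -- the filling of `C ∪ closure R`, so that shrinking `R` does not lose any of these points.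
  let good : Set (Set X) := {R | IsOpen R ∧ F ⊆ R ∧ IsCompact (closure R) ∧ closure R ⊆ Zᶜ ∧
    ∀ x ∈ R, (connectedComponentIn R x ∩ S).Nonempty}
  have hne : good.Nonempty := exists_relatively_compact_components_meet hZ.isClosed.isOpen_compl
    hF (fun x hx => hx.2.2) fun x hx => hS Z hZ x fun h => hx.2.2 (hZf h)
  let N : Set X → ℕ := fun R => (P ∩ fill (C ∪ closure R)).ncard
  obtain ⟨R, ⟨hRo, hFR, hRc, hRZ, hRS⟩, hmin⟩ :=
    (measure N).wf.has_min good hne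
  obtain ⟨R', hR'o, hFR', hR'c, hR'R, hR'S⟩ :=
    exists_relatively_compact_components_meet hRo hF hFR fun x hx => hRS x (hFR hx)
  have hR'good : R' ∈ good :=
    ⟨hR'o, hFR', hR'c, (hR'R.trans subset_closure).trans hRZ, hR'S⟩
  have hfillc : ∀ {Q : Set X}, IsCompact (closure Q) → IsCompact (fill (C ∪ closure Q)) :=
    fun h => isCompact_fill (hC.union h)
  have hmono : fill (C ∪ closure R') ⊆ fill (C ∪ closure R) :=
    fill_mono (Set.union_subset_union_right _ (hR'R.trans subset_closure))
  have heq : P ∩ fill (C ∪ closure R') = P ∩ fill (C ∪ closure R) := by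
    refine Set.eq_of_subset_of_ncard_le (Set.inter_subset_inter_right _ hmono) ?_
      (hP _ (hfillc hRc))
    exact not_lt.1 (hmin R' hR'good)
  have hDcl : IsClosed (C ∪ closure R') := hC.isClosed.union isClosed_closure
  have hCR : C ⊆ fill (C ∪ closure R) := Set.subset_union_left.trans (subset_fill _)
  refine ⟨fill (C ∪ closure R), R ∪ (fill (C ∪ closure R') \ (C ∪ closure R')), hfillc hRc,
    fill_fill_subset _, hZC.trans hCR, hRo.union (isOpen_fill_diff hDcl), ?_, ?_, ?_⟩
  · rintro x (hx | ⟨hx, hx'⟩)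
    · exact ⟨subset_fill _ (Or.inr (subset_closure hx)), hRZ (subset_closure hx)⟩
    · exact ⟨hmono hx, fun hxZ => hx' (Or.inl (hZC (Or.inl hxZ)))⟩
  · rintro x ⟨hxP, hx, hxZ⟩
    have hx' : x ∈ fill (C ∪ closure R') := (heq.ge ⟨hxP, hx⟩).2
    by_cases hxC : x ∈ C
    · exact Or.inl (hFR ⟨hxP, hxC, hxZ⟩)
    by_cases hxR : x ∈ closure R'
    · exact Or.inl (hR'R hxR)
    · exact Or.inr ⟨hx', fun h => h.elim hxC hxR⟩
  · rintro x (hx | ⟨hx, hx'⟩)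
    · exact (hRS x hx).mono (Set.inter_subset_inter_left _
        (connectedComponentIn_mono x Set.subset_union_left))
    -- A relatively compact component of the complement of `C ∪ closure R'` touches `closure R'`,
    -- since `C` is filled.
    set W := connectedComponentIn (C ∪ closure R')ᶜ x with hW
    have hxC : x ∉ C := fun h => hx' (Or.inl h)
    have hWO : W ⊆ fill (C ∪ closure R') \ (C ∪ closure R') := fun y hy =>
      ⟨(mem_fill_iff_of_mem_component hy).2 hx, connectedComponentIn_subset _ _ hy⟩
    obtain ⟨y, hyR, hyW⟩ : ∃ y ∈ closure R', y ∈ closure W := by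
      by_contra! hcon
      have hVW : connectedComponentIn Cᶜ x ⊆ W := by
        refine subset_component_of_disjoint_closure hDcl isPreconnected_connectedComponentIn
          (mem_connectedComponentIn hxC) hx' ?_
        rintro y hy (hyC | hyR)
        · exact absurd hyC (connectedComponentIn_subset _ _ hy)
        · exact hcon y hyR
      exact hxC (hCf (IsCompact.of_isClosed_subset hx isClosed_closure (closure_mono hVW)))
    have hyR' : y ∈ R := hR'R hyR
    obtain ⟨z, hzy, hzW⟩ := mem_closure_iff.1 hyW _ (hRo.connectedComponentIn (x := y))
      (mem_connectedComponentIn hyR')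
    obtain ⟨s, hs, hsS⟩ := hRS y hyR'
    refine ⟨s, ?_, hsS⟩
    have hpre : IsPreconnected (W ∪ connectedComponentIn R y) :=
      isPreconnected_connectedComponentIn.union z hzW hzy isPreconnected_connectedComponentIn
    exact hpre.subset_connectedComponentIn (Or.inl (mem_connectedComponentIn hx'))
      (Set.union_subset (hWO.trans Set.subset_union_right)
        ((connectedComponentIn_subset _ _).trans Set.subset_union_left)) (Or.inr hs)

theorem exists_isPieceFamily_of_noncompact [LocallyCompactSpace X] [T2Space X]
    [PreconnectedSpace X] [NoncompactSpace X] [SigmaCompactSpace X] {P S : Set X}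
    (hP : ∀ C : Set X, IsCompact C → (P ∩ C).Finite)
    (hS : ∀ C : Set X, IsCompact C → ∀ x ∉ fill C, (connectedComponentIn Cᶜ x ∩ S).Nonempty) :
    ∃ 𝒪, IsPieceFamily P S 𝒪 := by
  let K : CompactExhaustion X := default
  let T := {Z : Set X // IsCompact Z ∧ fill Z ⊆ Z}
  have step : ∀ (j : ℕ) (Z : T), ∃ (Z' : T) (O : Set X), Z.1 ∪ K j ⊆ Z'.1 ∧ IsOpen O ∧
      O ⊆ Z'.1 \ Z.1 ∧ P ∩ (Z'.1 \ Z.1) ⊆ O ∧ ∀ x ∈ O, (connectedComponentIn O x ∩ S).Nonempty := by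
    rintro j ⟨Z, hZ, hZf⟩
    obtain ⟨Z', O, h1, h2, h3⟩ := exists_fill_extension hP hS hZ hZf (K.isCompact j)
    exact ⟨⟨Z', h1, h2⟩, O, h3⟩
  choose next piece h1 h2 h3 h4 h5 using step
  have hfill0 : fill (∅ : Set X) ⊆ ∅ := by
    intro x hx
    rw [fill, Set.mem_ofPred_eq, Set.compl_empty, connectedComponentIn_univ,
      PreconnectedSpace.connectedComponent_eq_univ, closure_univ] at hx
    exact noncompact_univ X hx
  let Z : ℕ → T := fun j => Nat.rec ⟨∅, isCompact_empty, hfill0⟩ (fun j Z => next j Z) j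
  let O : ℕ → Set X := fun j => piece j (Z j)
  have hZsucc : ∀ j, (Z j).1 ∪ K j ⊆ (Z (j + 1)).1 := fun j => h1 j (Z j)
  have hOo : ∀ j, IsOpen (O j) := fun j => h2 j (Z j)
  have hOZ : ∀ j, O j ⊆ (Z (j + 1)).1 \ (Z j).1 := fun j => h3 j (Z j)
  have hPO : ∀ j, P ∩ ((Z (j + 1)).1 \ (Z j).1) ⊆ O j := fun j => h4 j (Z j)
  have hOS : ∀ j, ∀ x ∈ O j, (connectedComponentIn (O j) x ∩ S).Nonempty := fun j => h5 j (Z j)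
  have hmono : Monotone fun j => (Z j).1 :=
    monotone_nat_of_le_succ fun j => Set.subset_union_left.trans (hZsucc j)
  have hOdisj : ∀ i j, i < j → Disjoint (O i) (O j) := fun i j hij =>
    Set.disjoint_left.2 fun x hxi hxj => (hOZ j hxj).2 (hmono hij (hOZ i hxi).1)
  have hPfin : ∀ j, (P ∩ O j).Finite := fun j =>
    (hP _ (Z (j + 1)).2.1).subset fun x hx => ⟨hx.1, (hOZ j hx.2).1⟩
  refine ⟨{V | ∃ j, ∃ p ∈ P ∩ O j, V = connectedComponentIn (O j) p}, ?_, ?_, ?_, ?_, ?_, ?_, ?_,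
    ?_⟩
  · rintro _ ⟨j, p, -, rfl⟩
    exact (hOo j).connectedComponentIn
  · rintro _ ⟨j, p, -, rfl⟩
    exact isPreconnected_connectedComponentIn
  · rintro _ ⟨i, p, -, rfl⟩ _ ⟨j, q, -, rfl⟩ hne
    refine Set.disjoint_left.2 fun x hxp hxq => hne ?_
    have hij : i = j := by
      by_contra hij
      have hxi := connectedComponentIn_subset _ _ hxp
      have hxj := connectedComponentIn_subset _ _ hxq
      rcases lt_or_gt_of_ne hij with h | h
      · exact Set.disjoint_left.1 (hOdisj _ _ h) hxi hxj
      · exact Set.disjoint_left.1 (hOdisj _ _ h) hxj hxi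
    subst hij
    rw [connectedComponentIn_eq hxp, connectedComponentIn_eq hxq]
  · intro x
    obtain ⟨j, hj⟩ := K.exists_mem_nhds x
    refine ⟨K j, hj, ?_⟩
    have hfin : (⋃ i ∈ Set.Iic j, (fun p => connectedComponentIn (O i) p) '' (P ∩ O i)).Finite :=
      (Set.finite_Iic j).biUnion fun i _ => (hPfin i).image _
    refine hfin.subset ?_
    rintro _ ⟨⟨i, p, hp, rfl⟩, y, hy, hyK⟩
    refine Set.mem_biUnion (x := i) ?_ ⟨p, hp, rfl⟩
    by_contra hij
    rw [Set.mem_Iic, not_le] at hij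
    exact (hOZ i (connectedComponentIn_subset _ _ hy)).2
      (hmono (Nat.succ_le_of_lt hij) (hZsucc j (Or.inr hyK)))
  · intro p hp
    obtain ⟨j, hj⟩ := K.exists_mem p
    have hex : ∃ j, p ∈ (Z (j + 1)).1 := ⟨j, hZsucc j (Or.inr hj)⟩
    classical
    have hmem : p ∈ P ∩ O (Nat.find hex) := by
      refine ⟨hp, hPO _ ⟨hp, Nat.find_spec hex, ?_⟩⟩
      rcases Nat.eq_zero_or_eq_succ_pred (Nat.find hex) with h0 | h0
      · rw [h0]
        exact Set.notMem_empty p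
      · rw [h0]
        exact Nat.find_min hex (by omega)
    exact ⟨_, ⟨_, p, hmem, rfl⟩, mem_connectedComponentIn hmem.2⟩
  · rintro _ ⟨j, p, hp, rfl⟩
    exact ⟨p, hp.1, mem_connectedComponentIn hp.2⟩
  · rintro _ ⟨j, p, -, rfl⟩
    exact (hPfin j).subset (Set.inter_subset_inter_right _ (connectedComponentIn_subset _ _))
  · rintro _ ⟨j, p, hp, rfl⟩
    exact hOS j p hp.2

theorem isOpen_of_mem_components_univ {U : Set X}
    (hU : U ∈ components (Set.univ : Set X)) : IsOpen U := by
  obtain ⟨x, -, rfl⟩ := hU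
  exact isOpen_univ.connectedComponentIn

/-- A piece family may be found in one connected component at a time. -/
theorem exists_isPieceFamily_of_components {P S : Set X}
    (h : ∀ U ∈ components (Set.univ : Set X), (P ∩ U).Nonempty →
      ∃ 𝒪, IsPieceFamily (P ∩ U) S 𝒪 ∧ ∀ O ∈ 𝒪, O ⊆ U) :
    ∃ 𝒪, IsPieceFamily P S 𝒪 := by
  choose! 𝒪 h𝒪 hsub using h
  have hcomp : ∀ x : X, connectedComponentIn Set.univ x ∈ components (Set.univ : Set X) :=
    fun x => ⟨x, Set.mem_univ x, rfl⟩
  have hself : ∀ x : X, x ∈ connectedComponentIn Set.univ x := fun x =>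
    mem_connectedComponentIn (Set.mem_univ x)
  have hinter : ∀ U ∈ components (Set.univ : Set X), (P ∩ U).Nonempty → ∀ O ∈ 𝒪 U,
      P ∩ O = P ∩ U ∩ O := fun U hU hne O hO => by
    rw [Set.inter_assoc, Set.inter_eq_right.2 (hsub U hU hne O hO)]
  refine ⟨{O | ∃ U ∈ components (Set.univ : Set X), (P ∩ U).Nonempty ∧ O ∈ 𝒪 U},
    ?_, ?_, ?_, ?_, ?_, ?_, ?_, ?_⟩
  · rintro O ⟨U, hU, hne, hO⟩
    exact (h𝒪 U hU hne).isOpen O hO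
  · rintro O ⟨U, hU, hne, hO⟩
    exact (h𝒪 U hU hne).isPreconnected O hO
  · rintro O ⟨U, hU, hne, hO⟩ O' ⟨U', hU', hne', hO'⟩ hOO'
    refine Set.disjoint_left.2 fun x hx hx' => hOO' ?_
    obtain rfl := eq_of_mem_components_univ hU hU' (hsub U hU hne O hO hx)
      (hsub U' hU' hne' O' hO' hx')
    exact (h𝒪 U hU hne).pairwiseDisjoint.elim_set hO hO' x hx hx'
  · intro x
    have hxU := (isOpen_of_mem_components_univ (hcomp x)).mem_nhds (hself x)
    by_cases hne : (P ∩ connectedComponentIn Set.univ x).Nonempty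
    · obtain ⟨V, hV, hfin⟩ := (h𝒪 _ (hcomp x) hne).locallyFinite x
      refine ⟨V ∩ connectedComponentIn Set.univ x, Filter.inter_mem hV hxU, hfin.subset ?_⟩
      rintro O ⟨⟨U, hU, hne', hO⟩, y, hyO, hyV, hyx⟩
      obtain rfl := eq_of_mem_components_univ hU (hcomp x) (hsub U hU hne' O hO hyO) hyx
      exact ⟨hO, y, hyO, hyV⟩
    · refine ⟨connectedComponentIn Set.univ x, hxU, Set.finite_empty.subset ?_⟩
      rintro O ⟨⟨U, hU, hne', hO⟩, y, hyO, hyx⟩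
      obtain rfl := eq_of_mem_components_univ hU (hcomp x) (hsub U hU hne' O hO hyO) hyx
      exact hne hne'
  · intro p hp
    have hne : (P ∩ connectedComponentIn Set.univ p).Nonempty := ⟨p, hp, hself p⟩
    obtain ⟨O, hO, hpO⟩ := (h𝒪 _ (hcomp p) hne).subset_sUnion ⟨hp, hself p⟩
    exact ⟨O, ⟨_, hcomp p, hne, hO⟩, hpO⟩
  · rintro O ⟨U, hU, hne, hO⟩
    rw [hinter U hU hne O hO]
    exact (h𝒪 U hU hne).inter_nonempty O hO
  · rintro O ⟨U, hU, hne, hO⟩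
    rw [hinter U hU hne O hO]
    exact (h𝒪 U hU hne).inter_finite O hO
  · rintro O ⟨U, hU, hne, hO⟩
    exact (h𝒪 U hU hne).meets O hO

theorem exists_isPieceFamily_of_componentwiseNontrivial {g : X → X}
    (hg : ComponentwiseNontrivial g) {P : Set X} (hP : P.Finite) :
    ∃ 𝒪, IsPieceFamily P {x | g x ≠ x} 𝒪 := by
  refine exists_isPieceFamily_of_components fun U hU hne => ⟨{U}, ?_, ?_⟩
  · exact isPieceFamily_singleton (isOpen_of_mem_components_univ hU)
      (isPreconnected_of_mem_components_univ hU) hne (hP.subset Set.inter_subset_left) (hg U hU)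
  · rintro O rfl; exact subset_rfl

theorem exists_isPieceFamily_of_componentwiseEndNontrivial [LocallyCompactSpace X] [T2Space X]
    [SigmaCompactSpace X] {g : X → X} (hg : ComponentwiseEndNontrivial g) {P : Set X}
    (hP : ∀ C : Set X, IsCompact C → (P ∩ C).Finite) :
    ∃ 𝒪, IsPieceFamily P {x | g x ≠ x} 𝒪 := by
  refine exists_isPieceFamily_of_components fun U hU hne => ?_
  have hUo := isOpen_of_mem_components_univ hU
  have hUcl := isClosed_of_mem_components_univ hU
  have hUc := isPreconnected_of_mem_components_univ hU
  by_cases hcpt : IsCompact U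
  · refine ⟨{U}, isPieceFamily_singleton hUo hUc hne (hP U hcpt) (hg.1 U hU hcpt), ?_⟩
    rintro O rfl; exact subset_rfl
  have : LocallyConnectedSpace U := hUo.locallyConnectedSpace
  have : LocallyCompactSpace U := hUo.locallyCompactSpace
  have : SigmaCompactSpace U := hUcl.isClosedEmbedding_subtypeVal.sigmaCompactSpace
  have : PreconnectedSpace U := Subtype.preconnectedSpace hUc
  have : NoncompactSpace U := by
    rw [← not_compactSpace_iff, ← isCompact_iff_compactSpace]
    exact hcpt
  have hemb : Topology.IsClosedEmbedding (Subtype.val : U → X) := hUcl.isClosedEmbedding_subtypeVal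
  have hP' : ∀ C : Set U, IsCompact C → (Subtype.val ⁻¹' P ∩ C).Finite := fun C hC => by
    refine Set.Finite.of_finite_image ((hP _ (hC.image continuous_subtype_val)).subset ?_)
      Subtype.val_injective.injOn
    rintro _ ⟨x, ⟨hxP, hxC⟩, rfl⟩
    exact ⟨hxP, x, hxC, rfl⟩
  have hS' : ∀ C : Set U, IsCompact C → ∀ x ∉ fill C,
      (connectedComponentIn Cᶜ x ∩ Subtype.val ⁻¹' {x | g x ≠ x}).Nonempty := by
    intro C hC x hx
    have hxC : x ∈ Cᶜ := fun h => hx (subset_fill C h)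
    have hval : Subtype.val '' Cᶜ = U \ Subtype.val '' C := by
      ext y
      constructor
      · rintro ⟨z, hz, rfl⟩
        exact ⟨z.2, fun ⟨w, hw, hwz⟩ => hz (Subtype.val_injective hwz ▸ hw)⟩
      · rintro ⟨hyU, hy⟩
        exact ⟨⟨y, hyU⟩, fun h => hy ⟨_, h, rfl⟩, rfl⟩
    set V := connectedComponentIn (U \ Subtype.val '' C) (x : X) with hV
    have hxV : (x : X) ∈ U \ Subtype.val '' C := hval ▸ ⟨x, hxC, rfl⟩
    have hsub : Subtype.val '' (connectedComponentIn Cᶜ x) ⊆ V := by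
      refine (isPreconnected_connectedComponentIn.image _
        continuous_subtype_val.continuousOn).subset_connectedComponentIn
        ⟨x, mem_connectedComponentIn hxC, rfl⟩ ?_
      rw [← hval]
      exact Set.image_mono (connectedComponentIn_subset _ _)
    have hVU : V ⊆ U := (connectedComponentIn_subset _ _).trans Set.sdiff_subset
    have hVim : Subtype.val '' (Subtype.val ⁻¹' V : Set U) = V := by
      rw [Subtype.image_preimage_coe, Set.inter_eq_right.2 hVU]
    have hncpt : ¬ IsCompact (closure V) := fun hVc => hx <| by
      have h1 := hVc.of_isClosed_subset isClosed_closure (closure_mono hsub)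
      rw [hemb.closure_image_eq, hemb.isEmbedding.isCompact_iff.symm] at h1
      exact h1
    obtain ⟨y, hyV, hy⟩ := hg.2 U hU hcpt _ (Subtype.coe_image_subset U C)
      (hC.image continuous_subtype_val) V ⟨x, hxV, rfl⟩ hncpt
    refine ⟨⟨y, hVU hyV⟩, ?_, hy⟩
    have hpre : IsPreconnected (Subtype.val ⁻¹' V : Set U) := by
      rw [← hemb.isInducing.isPreconnected_image, hVim]
      exact isPreconnected_connectedComponentIn
    refine hpre.subset_connectedComponentIn (mem_connectedComponentIn hxV) ?_ hyV
    intro z hz hzC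
    exact (connectedComponentIn_subset _ _ hz).2 ⟨z, hzC, rfl⟩
  obtain ⟨𝒪, h⟩ := exists_isPieceFamily_of_noncompact hP' hS'
  refine ⟨Set.image Subtype.val '' 𝒪, ⟨?_, ?_, ?_, ?_, ?_, ?_, ?_, ?_⟩, ?_⟩
  · rintro _ ⟨O, hO, rfl⟩
    exact hUo.isOpenMap_subtype_val _ (h.isOpen O hO)
  · rintro _ ⟨O, hO, rfl⟩
    exact (h.isPreconnected O hO).image _ continuous_subtype_val.continuousOn
  · rintro _ ⟨O, hO, rfl⟩ _ ⟨O', hO', rfl⟩ hne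
    exact (Set.disjoint_image_iff Subtype.val_injective).2
      (h.pairwiseDisjoint hO hO' fun heq => hne (heq ▸ rfl))
  · intro x
    by_cases hxU : x ∈ U
    · obtain ⟨V, hV, hfin⟩ := h.locallyFinite ⟨x, hxU⟩
      refine ⟨Subtype.val '' V, hUo.isOpenMap_subtype_val.image_mem_nhds hV,
        (hfin.image (Set.image Subtype.val)).subset ?_⟩
      rintro _ ⟨⟨O, hO, rfl⟩, _, ⟨y, hy, rfl⟩, z, hz, hzy⟩
      exact ⟨O, ⟨hO, y, hy, Subtype.val_injective hzy ▸ hz⟩, rfl⟩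
    · refine ⟨Uᶜ, hUcl.isOpen_compl.mem_nhds hxU, Set.finite_empty.subset ?_⟩
      rintro _ ⟨⟨O, hO, rfl⟩, _, ⟨y, hy, rfl⟩, hyU⟩
      exact hyU y.2
  · rintro p ⟨hp, hpU⟩
    obtain ⟨O, hO, hpO⟩ := h.subset_sUnion (show (⟨p, hpU⟩ : U) ∈ Subtype.val ⁻¹' P from hp)
    exact ⟨_, ⟨O, hO, rfl⟩, _, hpO, rfl⟩
  · rintro _ ⟨O, hO, rfl⟩
    obtain ⟨p, hp, hpO⟩ := h.inter_nonempty O hO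
    exact ⟨p, ⟨hp, p.2⟩, p, hpO, rfl⟩
  · rintro _ ⟨O, hO, rfl⟩
    refine ((h.inter_finite O hO).image Subtype.val).subset ?_
    rintro _ ⟨⟨hp, -⟩, p, hpO, rfl⟩
    exact ⟨p, ⟨hp, hpO⟩, rfl⟩
  · rintro _ ⟨O, hO, rfl⟩
    obtain ⟨s, hs, hsS⟩ := h.meets O hO
    exact ⟨s, ⟨s, hs, rfl⟩, hsS⟩
  · rintro _ ⟨O, hO, rfl⟩
    exact Subtype.coe_image_subset U O

end Filling

/-! ### Small perturbations of the identity of a normed space -/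

section EuclideanPush

variable {V : Type*} [NormedAddCommGroup V] [NormedSpace ℝ V] [CompleteSpace V]

/-- A small multiple of a compactly supported smooth vector field, added to the identity, is a
diffeomorphism. -/
theorem exists_diffeo_id_add_smul {Y : V → V} (hY : ContDiff ℝ ∞ Y) (hc : HasCompactSupport Y) :
    ∃ s₀ : ℝ, 0 < s₀ ∧ ∀ s : ℝ, 0 ≤ s → s ≤ s₀ → ∃ e : V ≃ V, (∀ x, e x = x + s • Y x) ∧
      ContDiff ℝ ∞ e ∧ ContDiff ℝ ∞ e.symm := by
  obtain ⟨L, hL⟩ := hY.lipschitzWith_of_hasCompactSupport hc (by simp)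
  have hLpos : (0 : ℝ) < L + 1 := by positivity
  refine ⟨1 / (2 * (L + 1)), by positivity, fun s hs0 hs => ?_⟩
  lift s to NNReal using hs0
  have hsL : s * L < 1 := by
    have h1 : (s : ℝ) * (2 * (L + 1)) ≤ 1 := by rwa [le_div_iff₀ (by positivity)] at hs
    have h2 : (s : ℝ) * L < 1 := by nlinarith [s.coe_nonneg, L.coe_nonneg]
    exact_mod_cast h2
  rcases subsingleton_or_nontrivial V with hV | hV
  · exact ⟨Equiv.refl V, fun x => Subsingleton.elim _ _, contDiff_id, contDiff_id⟩
  set f : V → V := fun x => x + (s : ℝ) • Y x with hf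
  have hfs : ContDiff ℝ ∞ f := contDiff_id.add (contDiff_const.smul hY)
  have happ : ApproximatesLinearOn f ((ContinuousLinearEquiv.refl ℝ V : V ≃L[ℝ] V) : V →L[ℝ] V)
      Set.univ (s * L) := by
    intro x _ y _
    have hxy : f x - f y - ((ContinuousLinearEquiv.refl ℝ V : V ≃L[ℝ] V) : V →L[ℝ] V) (x - y) =
        (s : ℝ) • (Y x - Y y) := by
      simp only [hf, ContinuousLinearEquiv.coe_refl, ContinuousLinearMap.id_apply, smul_sub]
      abel
    rw [hxy, norm_smul, NNReal.norm_eq, NNReal.coe_mul, mul_assoc]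
    exact mul_le_mul_of_nonneg_left (hL.norm_sub_le x y) s.coe_nonneg
  have hnorm : s * L < ‖((ContinuousLinearEquiv.refl ℝ V).symm : V →L[ℝ] V)‖₊⁻¹ := by
    have : ‖((ContinuousLinearEquiv.refl ℝ V).symm : V →L[ℝ] V)‖₊ = 1 := by
      simp [ContinuousLinearMap.nnnorm_id]
    rwa [this, inv_one]
  let h : V ≃ₜ V := happ.toHomeomorph f (Or.inr hnorm)
  have hh : ∀ x, h x = f x := fun x => rfl
  refine ⟨h.toEquiv, fun x => rfl, hfs, contDiff_iff_contDiffAt.2 fun a => ?_⟩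
  have hD : ∀ x, ‖(s : ℝ) • fderiv ℝ Y x‖ < 1 := fun x => by
    rw [norm_smul, NNReal.norm_eq]
    refine (mul_le_mul_of_nonneg_left (norm_fderiv_le_of_lipschitz ℝ hL) s.coe_nonneg).trans_lt ?_
    exact_mod_cast hsL
  let U : (V →L[ℝ] V)ˣ := Units.oneSub (-((s : ℝ) • fderiv ℝ Y (h.symm a))) (by
    rw [norm_neg]; exact hD _)
  have hder : HasFDerivAt f ((ContinuousLinearEquiv.unitsEquiv ℝ V U : V ≃L[ℝ] V) : V →L[ℝ] V)
      (h.symm a) := by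
    have h1 : HasFDerivAt f (ContinuousLinearMap.id ℝ V + (s : ℝ) • fderiv ℝ Y (h.symm a))
        (h.symm a) :=
      (hasFDerivAt_id _).add
        (((hY.differentiable (by simp)) (h.symm a)).hasFDerivAt.const_smul (s : ℝ))
    convert h1 using 1
    ext v
    simp [U]
  exact h.toOpenPartialHomeomorph.contDiffAt_symm (Set.mem_univ a) hder hfs.contDiffAt

end EuclideanPush

/-! ### Isotopies with prescribed support -/

section Isotopy

variable {n : ℕ} {H : Type*} [TopologicalSpace H]
  {I : ModelWithCorners ℝ (EuclideanSpace ℝ (Fin n)) H}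
  {M : Type*} [TopologicalSpace M] [ChartedSpace H M] {r : WithTop ℕ∞}

/-- `F` is an isotopy starting at the identity which is stationary outside `A`. -/
def IsIsotopyIn (A : Set M) (F : CylDiffeo I r M) : Prop :=
  IsIsotopy F ∧ (∀ x, F (x, 0) = (x, 0)) ∧ ∀ x ∉ A, ∀ t, F (x, t) = (x, t)

/-- `f` is the end of an isotopy starting at the identity which is stationary outside `A`. -/
def IsotopicIn (A : Set M) (f : M ≃ₘ^r⟮I, I⟯ M) : Prop :=
  ∃ F : CylDiffeo I r M, IsIsotopyIn A F ∧ EndsAt F f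

theorem IsIsotopyIn.mono {A B : Set M} {F : CylDiffeo I r M} (h : IsIsotopyIn A F)
    (hAB : A ⊆ B) : IsIsotopyIn B F :=
  ⟨h.1, h.2.1, fun x hx => h.2.2 x fun hxA => hx (hAB hxA)⟩

theorem IsIsotopyIn.trans {A : Set M} {F F' : CylDiffeo I r M} (h : IsIsotopyIn A F)
    (h' : IsIsotopyIn A F') : IsIsotopyIn A (F'.trans F) := by
  obtain ⟨h1, h2, h3⟩ := h
  obtain ⟨h1', h2', h3'⟩ := h'
  refine ⟨fun p => ?_, fun x => ?_, fun x hx t => ?_⟩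
  · change (F (F' p)).2 = p.2
    rw [h1, h1']
  · change F (F' (x, 0)) = (x, 0)
    rw [h2', h2]
  · change F (F' (x, t)) = (x, t)
    rw [h3' x hx, h3 x hx]

theorem IsIsotopyIn.symm {A : Set M} {F : CylDiffeo I r M} (h : IsIsotopyIn A F) :
    IsIsotopyIn A F.symm := by
  obtain ⟨h1, h2, h3⟩ := h
  refine ⟨fun p => ?_, fun x => symm_eq_of_eq (h2 x), fun x hx t => symm_eq_of_eq (h3 x hx t)⟩
  have := h1 (F.symm p)
  rw [F.apply_symm_apply] at this
  exact this.symm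

theorem IsIsotopyIn.apply_eq {A : Set M} {F : CylDiffeo I r M} (h : IsIsotopyIn A F) (x : M)
    (t : Set.Icc (0 : ℝ) 1) : F (x, t) = ((F (x, t)).1, t) :=
  Prod.ext rfl (h.1 (x, t))

/-- An isotopy which is stationary outside `A` preserves `A`. -/
theorem IsIsotopyIn.fst_mem {A : Set M} {F : CylDiffeo I r M} (h : IsIsotopyIn A F) {x : M}
    (hx : x ∈ A) (t : Set.Icc (0 : ℝ) 1) : (F (x, t)).1 ∈ A := by
  by_contra hcon
  have h1 := h.2.2 _ hcon t
  rw [← h.apply_eq] at h1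
  exact hcon ((Prod.ext_iff.1 (F.injective h1)).1 ▸ hx)

theorem IsotopicIn.mono {A B : Set M} {f : M ≃ₘ^r⟮I, I⟯ M} (h : IsotopicIn A f)
    (hAB : A ⊆ B) : IsotopicIn B f :=
  let ⟨F, hF, hf⟩ := h
  ⟨F, hF.mono hAB, hf⟩

theorem IsotopicIn.one (A : Set M) : IsotopicIn A (1 : M ≃ₘ^r⟮I, I⟯ M) :=
  ⟨Diffeomorph.refl _ _ r, ⟨fun _ => rfl, fun _ => rfl, fun _ _ _ => rfl⟩, fun _ => rfl⟩

theorem IsotopicIn.mul {A : Set M} {f f' : M ≃ₘ^r⟮I, I⟯ M} (h : IsotopicIn A f)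
    (h' : IsotopicIn A f') : IsotopicIn A (f * f') :=
  let ⟨_, h1, h2⟩ := h
  let ⟨_, h1', h2'⟩ := h'
  ⟨_, h1.trans h1', h2.trans h2'⟩

theorem IsotopicIn.apply_eq_self {A : Set M} {f : M ≃ₘ^r⟮I, I⟯ M} (h : IsotopicIn A f) {x : M}
    (hx : x ∉ A) : f x = x := by
  obtain ⟨F, hF, hf⟩ := h
  have := hf x
  rw [hF.2.2 x hx] at this
  exact (Prod.ext_iff.1 this).1.symm

/-- Isotopies which are stationary outside a closed subset of the interior are stationary near
the boundary. -/
theorem IsIsotopyIn.isIsotopyRel {A : Set M} {F : CylDiffeo I r M} (h : IsIsotopyIn A F)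
    (hA : IsClosed A) (hAI : A ⊆ I.interior M) : IsIsotopyRel (I.boundary M) F := by
  refine ⟨h.1, h.2.1, Aᶜ, ?_, fun x hx => h.2.2 x hx⟩
  rw [hA.isOpen_compl.mem_nhdsSet, ← I.compl_interior]
  exact Set.compl_subset_compl.2 hAI

/-- The end of an isotopy, as a diffeomorphism. -/
theorem IsIsotopy.exists_endsAt {F : CylDiffeo I r M} (h : IsIsotopy F) :
    ∃ f : M ≃ₘ^r⟮I, I⟯ M, EndsAt F f := by
  have key : ∀ (F : CylDiffeo I r M), ContMDiff I I r fun x : M => (F (x, 1)).1 := fun F =>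
    contMDiff_fst.comp (F.contMDiff_toFun.comp (contMDiff_id.prodMk contMDiff_const))
  have hsnd : ∀ x : M, F (x, 1) = ((F (x, 1)).1, 1) := fun x => Prod.ext rfl (h _)
  have hsnd' : ∀ x : M, F.symm (x, 1) = ((F.symm (x, 1)).1, 1) := fun x => by
    refine Prod.ext rfl ?_
    have := h (F.symm (x, 1))
    rw [F.apply_symm_apply] at this
    exact this.symm
  refine ⟨⟨⟨fun x => (F (x, 1)).1, fun x => (F.symm (x, 1)).1, fun x => ?_, fun x => ?_⟩,
    key F, key F.symm⟩, hsnd⟩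
  · change (F.symm ((F (x, 1)).1, 1)).1 = x
    rw [← hsnd, F.symm_apply_apply]
  · change (F ((F.symm (x, 1)).1, 1)).1 = x
    rw [← hsnd', F.apply_symm_apply]

/-- The diffeomorphism `(x, t) ↦ (u (x, t), t)` of `M × [0,1]` with inverse
`(x, t) ↦ (v (x, t), t)`. -/
def cylDiffeoOfFst (u v : M × Set.Icc (0 : ℝ) 1 → M)
    (hu : ContMDiff (I.prod (𝓡∂ 1)) I r u) (hv : ContMDiff (I.prod (𝓡∂ 1)) I r v)
    (hvu : ∀ x t, v (u (x, t), t) = x) (huv : ∀ x t, u (v (x, t), t) = x) :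
    CylDiffeo I r M where
  toFun p := (u p, p.2)
  invFun p := (v p, p.2)
  left_inv p := Prod.ext (hvu p.1 p.2) rfl
  right_inv p := Prod.ext (huv p.1 p.2) rfl
  contMDiff_toFun := hu.prodMk contMDiff_snd
  contMDiff_invFun := hv.prodMk contMDiff_snd

section Glue

variable {ι : Type*}

open Classical in
/-- The first component of the map of `M × [0,1]` which agrees with `F i` over `A i` and with the
identity outside. -/
noncomputable def glueFst (A : ι → Set M) (F : ι → CylDiffeo I r M)
    (p : M × Set.Icc (0 : ℝ) 1) : M :=
  if h : ∃ i, p.1 ∈ A i then (F h.choose p).1 else p.1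

variable {A : ι → Set M} {F : ι → CylDiffeo I r M}

theorem glueFst_of_mem (hdisj : Pairwise fun i j => Disjoint (A i) (A j)) {i : ι} {x : M}
    (hx : x ∈ A i) (t : Set.Icc (0 : ℝ) 1) : glueFst A F (x, t) = (F i (x, t)).1 := by
  have h : ∃ i, x ∈ A i := ⟨i, hx⟩
  have hi : h.choose = i := by
    by_contra hne
    exact Set.disjoint_left.1 (hdisj hne) h.choose_spec hx
  rw [glueFst, dif_pos h, hi]

theorem glueFst_of_notMem {x : M} (hx : ∀ i, x ∉ A i) (t : Set.Icc (0 : ℝ) 1) :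
    glueFst A F (x, t) = x := by
  rw [glueFst, dif_neg (by simpa using hx)]

theorem contMDiff_glueFst (hF : ∀ i, IsIsotopyIn (A i) (F i)) (hcl : ∀ i, IsClosed (A i))
    (hlf : LocallyFinite A) (hdisj : Pairwise fun i j => Disjoint (A i) (A j)) :
    ContMDiff (I.prod (𝓡∂ 1)) I r (glueFst A F) := by
  rintro ⟨x, t⟩
  by_cases hx : ∃ i, x ∈ A i
  · obtain ⟨i, hi⟩ := hx
    have hopen : IsOpen (⋃ j : {j // j ≠ i}, A j)ᶜ :=
      ((hlf.comp_injective Subtype.val_injective).isClosed_iUnion fun j => hcl j.1).isOpen_compl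
    have hmem : x ∈ (⋃ j : {j // j ≠ i}, A j)ᶜ := by
      rw [Set.mem_compl_iff, Set.mem_iUnion]
      rintro ⟨⟨j, hj⟩, hxj⟩
      exact Set.disjoint_left.1 (hdisj hj) hxj hi
    refine ContMDiffAt.congr_of_eventuallyEq (f := fun p => (F i p).1)
      (contMDiff_fst.comp (F i).contMDiff_toFun).contMDiffAt ?_
    filter_upwards [(hopen.preimage continuous_fst).mem_nhds
      (show ((x, t) : M × Set.Icc (0 : ℝ) 1) ∈ _ from hmem)]
    rintro ⟨y, s⟩ hy
    by_cases hyi : y ∈ A i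
    · exact glueFst_of_mem hdisj hyi s
    · rw [glueFst_of_notMem, (hF i).2.2 y hyi]
      intro j hj
      refine hy (Set.mem_iUnion.2 ⟨⟨j, ?_⟩, hj⟩)
      rintro rfl
      exact hyi hj
  · push Not at hx
    have hopen : IsOpen (⋃ j, A j)ᶜ := (hlf.isClosed_iUnion hcl).isOpen_compl
    refine ContMDiffAt.congr_of_eventuallyEq (f := Prod.fst) contMDiff_fst.contMDiffAt ?_
    filter_upwards [(hopen.preimage continuous_fst).mem_nhds
      (show ((x, t) : M × Set.Icc (0 : ℝ) 1) ∈ _ by simpa using hx)]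
    rintro ⟨y, s⟩ hy
    exact glueFst_of_notMem (by simpa using hy) s

/-- Isotopies supported in the members of a locally finite family of disjoint closed sets can be
performed simultaneously. -/
theorem exists_glue_isIsotopyIn (hF : ∀ i, IsIsotopyIn (A i) (F i)) (hcl : ∀ i, IsClosed (A i))
    (hlf : LocallyFinite A) (hdisj : Pairwise fun i j => Disjoint (A i) (A j)) :
    ∃ F' : CylDiffeo I r M, IsIsotopyIn (⋃ i, A i) F' ∧
      ∀ i, ∀ x ∈ A i, ∀ t, F' (x, t) = F i (x, t) := by
  have hsymm : ∀ i, IsIsotopyIn (A i) (F i).symm := fun i => (hF i).symm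
  have inv : ∀ {F G : ι → CylDiffeo I r M}, (∀ i, IsIsotopyIn (A i) (F i)) →
      (∀ i, IsIsotopyIn (A i) (G i)) → (∀ i p, G i (F i p) = p) →
      ∀ x t, glueFst A G (glueFst A F (x, t), t) = x := by
    intro F G hF hG hGF x t
    by_cases hx : ∃ i, x ∈ A i
    · obtain ⟨i, hi⟩ := hx
      rw [glueFst_of_mem hdisj hi, glueFst_of_mem hdisj ((hF i).fst_mem hi t),
        ← (hF i).apply_eq, hGF]
    · push Not at hx
      rw [glueFst_of_notMem hx, glueFst_of_notMem hx]
  refine ⟨cylDiffeoOfFst (glueFst A F) (glueFst A fun i => (F i).symm)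
    (contMDiff_glueFst hF hcl hlf hdisj) (contMDiff_glueFst hsymm hcl hlf hdisj)
    (inv hF hsymm fun i p => (F i).symm_apply_apply p)
    (inv hsymm hF fun i p => (F i).apply_symm_apply p), ⟨fun p => rfl, fun x => ?_, ?_⟩, ?_⟩
  · refine Prod.ext ?_ rfl
    change glueFst A F (x, 0) = x
    by_cases hx : ∃ i, x ∈ A i
    · obtain ⟨i, hi⟩ := hx
      rw [glueFst_of_mem hdisj hi, (hF i).2.1]
    · push Not at hx
      exact glueFst_of_notMem hx 0
  · intro x hx t
    exact Prod.ext (glueFst_of_notMem (by simpa using hx) t) rfl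
  · intro i x hx t
    rw [(hF i).apply_eq]
    exact Prod.ext (glueFst_of_mem hdisj hx t) rfl

end Glue

section Transport

open Classical in
/-- The first component of the map of `M × [0,1]` which is `e`, read through the chart `φ`, and
the identity outside the image of the chart. -/
noncomputable def transportFst (φ : OpenPartialHomeomorph (EuclideanSpace ℝ (Fin n)) M)
    (e : EuclideanSpace ℝ (Fin n) × ℝ → EuclideanSpace ℝ (Fin n) × ℝ)
    (p : M × Set.Icc (0 : ℝ) 1) : M :=
  if p.1 ∈ φ.target then φ (e (φ.symm p.1, (p.2 : ℝ))).1 else p.1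

variable {φ : OpenPartialHomeomorph (EuclideanSpace ℝ (Fin n)) M}
  {K : Set (EuclideanSpace ℝ (Fin n))}

theorem transportFst_apply (e : EuclideanSpace ℝ (Fin n) × ℝ → EuclideanSpace ℝ (Fin n) × ℝ)
    {x : EuclideanSpace ℝ (Fin n)} (hx : x ∈ φ.source) (t : Set.Icc (0 : ℝ) 1) :
    transportFst φ e (φ x, t) = φ (e (x, (t : ℝ))).1 := by
  rw [transportFst, if_pos (φ.map_source hx), φ.left_inv hx]

theorem transportFst_of_notMem {e : EuclideanSpace ℝ (Fin n) × ℝ → EuclideanSpace ℝ (Fin n) × ℝ}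
    (hfix : ∀ x ∉ K, ∀ t, e (x, t) = (x, t)) {m : M} (hm : m ∉ φ '' K) (t : Set.Icc (0 : ℝ) 1) :
    transportFst φ e (m, t) = m := by
  by_cases hmt : m ∈ φ.target
  · obtain ⟨x, hx, rfl⟩ : ∃ x ∈ φ.source, φ x = m := ⟨_, φ.map_target hmt, φ.right_inv hmt⟩
    rw [transportFst_apply e hx, hfix x fun hxK => hm ⟨x, hxK, rfl⟩]
  · rw [transportFst, if_neg hmt]

theorem contMDiff_transportFst [T2Space M] (hr : r ≤ ∞)
    (hφ : ContMDiffOn (𝓡 n) I r φ φ.source) (hφ' : ContMDiffOn I (𝓡 n) r φ.symm φ.target)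
    (hK : IsCompact K) (hKφ : K ⊆ φ.source)
    {e : EuclideanSpace ℝ (Fin n) × ℝ → EuclideanSpace ℝ (Fin n) × ℝ} (he : ContDiff ℝ ∞ e)
    (hfix : ∀ x ∉ K, ∀ t, e (x, t) = (x, t)) (hmap : ∀ x ∈ K, ∀ t, (e (x, t)).1 ∈ K) :
    ContMDiff (I.prod (𝓡∂ 1)) I r (transportFst φ e) := by
  rintro ⟨m, t⟩
  by_cases hm : m ∈ φ '' K
  · have hmt : m ∈ φ.target := by
      obtain ⟨x, hx, rfl⟩ := hm
      exact φ.map_source (hKφ hx)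
    have hnhds : {p : M × Set.Icc (0 : ℝ) 1 | p.1 ∈ φ.target} ∈ 𝓝 (m, t) :=
      (φ.open_target.preimage continuous_fst).mem_nhds hmt
    refine ContMDiffAt.congr_of_eventuallyEq
      (f := fun p : M × Set.Icc (0 : ℝ) 1 => φ (e (φ.symm p.1, (p.2 : ℝ))).1) ?_ ?_
    · have h1 : ContMDiffAt (I.prod (𝓡∂ 1)) (𝓡 n) r
          (fun p : M × Set.Icc (0 : ℝ) 1 => φ.symm p.1) (m, t) :=
        ContMDiffAt.comp (m, t) (hφ'.contMDiffAt (φ.open_target.mem_nhds hmt))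
          contMDiff_fst.contMDiffAt
      have h2 : ContMDiffAt (I.prod (𝓡∂ 1)) 𝓘(ℝ, ℝ) r
          (fun p : M × Set.Icc (0 : ℝ) 1 => (p.2 : ℝ)) (m, t) :=
        (contMDiff_subtypeVal_Icc.comp contMDiff_snd).contMDiffAt
      have h3 : ContMDiffAt 𝓘(ℝ, EuclideanSpace ℝ (Fin n) × ℝ) (𝓡 n) r
          (fun q => (e q).1) (φ.symm m, (t : ℝ)) :=
        ((contDiff_fst.comp he).contMDiff.of_le hr).contMDiffAt
      have h4 : ContMDiffAt (I.prod (𝓡∂ 1)) (𝓡 n) r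
          (fun p : M × Set.Icc (0 : ℝ) 1 => (e (φ.symm p.1, (p.2 : ℝ))).1) (m, t) :=
        ContMDiffAt.comp (m, t) (g := fun q => (e q).1)
          (f := fun p : M × Set.Icc (0 : ℝ) 1 => (φ.symm p.1, (p.2 : ℝ))) h3 (h1.prodMk_space h2)
      refine ContMDiffAt.comp (m, t) (hφ.contMDiffAt (φ.open_source.mem_nhds ?_)) h4
      obtain ⟨x, hx, rfl⟩ := hm
      change (e (φ.symm (φ x), (t : ℝ))).1 ∈ φ.source
      rw [φ.left_inv (hKφ hx)]
      exact hKφ (hmap x hx t)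
    · filter_upwards [hnhds] with p hp
      rw [transportFst, if_pos hp]
  · have hcl : IsClosed (φ '' K) := (hK.image_of_continuousOn (φ.continuousOn.mono hKφ)).isClosed
    refine ContMDiffAt.congr_of_eventuallyEq (f := Prod.fst) contMDiff_fst.contMDiffAt ?_
    filter_upwards [(hcl.isOpen_compl.preimage continuous_fst).mem_nhds
      (show ((m, t) : M × Set.Icc (0 : ℝ) 1) ∈ _ from hm)]
    rintro ⟨m', s⟩ hm'
    exact transportFst_of_notMem hfix hm' s

/-- A level-preserving diffeomorphism of `ℝⁿ × ℝ`, supported over a compact subset of the source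
of a chart, induces an isotopy of `M`. -/
theorem exists_transport_isIsotopyIn [T2Space M] (hr : r ≤ ∞)
    (hφ : ContMDiffOn (𝓡 n) I r φ φ.source) (hφ' : ContMDiffOn I (𝓡 n) r φ.symm φ.target)
    (hK : IsCompact K) (hKφ : K ⊆ φ.source)
    (e : EuclideanSpace ℝ (Fin n) × ℝ ≃ EuclideanSpace ℝ (Fin n) × ℝ) (he : ContDiff ℝ ∞ e)
    (he' : ContDiff ℝ ∞ e.symm) (hlevel : ∀ x t, (e (x, t)).2 = t)
    (hfix : ∀ x ∉ K, ∀ t, e (x, t) = (x, t)) (hzero : ∀ x, e (x, 0) = (x, 0)) :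
    ∃ F : CylDiffeo I r M, IsIsotopyIn (φ '' K) F ∧
      ∀ x ∈ φ.source, ∀ t, F (φ x, t) = (φ (e (x, (t : ℝ))).1, t) := by
  have heq : ∀ x t, ((e (x, t)).1, t) = e (x, t) := fun x t => Prod.ext rfl (hlevel x t).symm
  have hlevel' : ∀ x t, (e.symm (x, t)).2 = t := fun x t => by
    have := hlevel (e.symm (x, t)).1 (e.symm (x, t)).2
    rw [Prod.mk.eta, e.apply_symm_apply] at this
    exact this.symm
  have heq' : ∀ x t, ((e.symm (x, t)).1, t) = e.symm (x, t) := fun x t =>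
    Prod.ext rfl (hlevel' x t).symm
  have hfix' : ∀ x ∉ K, ∀ t, e.symm (x, t) = (x, t) := fun x hx t => by
    rw [e.symm_apply_eq, hfix x hx]
  have hmap : ∀ x ∈ K, ∀ t, (e (x, t)).1 ∈ K := fun x hx t => by
    by_contra hcon
    have h1 := hfix _ hcon t
    rw [heq] at h1
    exact hcon ((Prod.ext_iff.1 (e.injective h1)).1 ▸ hx)
  have hmap' : ∀ x ∈ K, ∀ t, (e.symm (x, t)).1 ∈ K := fun x hx t => by
    by_contra hcon
    have h1 := hfix _ hcon t
    rw [heq', e.apply_symm_apply] at h1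
    exact hcon ((Prod.ext_iff.1 h1).1 ▸ hx)
  have hsource : ∀ x ∈ φ.source, ∀ t, (e (x, t)).1 ∈ φ.source := fun x hx t => by
    by_cases hxK : x ∈ K
    · exact hKφ (hmap x hxK t)
    · rwa [hfix x hxK]
  have hsource' : ∀ x ∈ φ.source, ∀ t, (e.symm (x, t)).1 ∈ φ.source := fun x hx t => by
    by_cases hxK : x ∈ K
    · exact hKφ (hmap' x hxK t)
    · rwa [hfix' x hxK]
  have inv : ∀ (m : M) (t : Set.Icc (0 : ℝ) 1),
      transportFst φ e.symm (transportFst φ e (m, t), t) = m ∧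
        transportFst φ e (transportFst φ e.symm (m, t), t) = m := by
    intro m t
    by_cases hm : m ∈ φ.target
    · obtain ⟨x, hx, rfl⟩ : ∃ x ∈ φ.source, φ x = m := ⟨_, φ.map_target hm, φ.right_inv hm⟩
      rw [transportFst_apply e hx, transportFst_apply e.symm hx,
        transportFst_apply e.symm (hsource x hx t), transportFst_apply e (hsource' x hx t),
        heq, heq', e.symm_apply_apply, e.apply_symm_apply]
      exact ⟨rfl, rfl⟩
    · have h1 : ∀ e', transportFst φ e' (m, t) = m := fun e' => by
        rw [transportFst, if_neg hm]
      rw [h1, h1, h1]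
      exact ⟨rfl, rfl⟩
  refine ⟨cylDiffeoOfFst (transportFst φ e) (transportFst φ e.symm)
    (contMDiff_transportFst hr hφ hφ' hK hKφ he hfix hmap)
    (contMDiff_transportFst hr hφ hφ' hK hKφ he' hfix' hmap')
    (fun m t => (inv m t).1) (fun m t => (inv m t).2), ⟨fun p => rfl, fun m => ?_, ?_⟩, ?_⟩
  · refine Prod.ext ?_ rfl
    change transportFst φ e (m, 0) = m
    by_cases hm : m ∈ φ.target
    · obtain ⟨x, hx, rfl⟩ : ∃ x ∈ φ.source, φ x = m := ⟨_, φ.map_target hm, φ.right_inv hm⟩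
      rw [transportFst_apply e hx]
      exact congrArg (fun q => φ q.1) (hzero x)
    · rw [transportFst, if_neg hm]
  · intro m hm t
    exact Prod.ext (transportFst_of_notMem hfix hm t) rfl
  · intro x hx t
    exact Prod.ext (transportFst_apply e hx t) rfl

end Transport

end Isotopy

/-! ### Contractions of balls in Euclidean space -/

section EuclideanContraction

variable {E : Type*} [NormedAddCommGroup E] [NormedSpace ℝ E] [FiniteDimensional ℝ E]

/-- A level-preserving diffeomorphism of `E × ℝ`, supported over a closed ball of radius `ρ'`, which
starts at the identity and at time `1` contracts a smaller concentric ball towards the point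
`y`. -/
theorem exists_contraction {c y : E} {ρ ρ' : ℝ} (hρ : 0 < ρ) (hρ' : ρ < ρ') :
    ∃ (s : ℝ) (e : E × ℝ ≃ E × ℝ), 0 < s ∧ s ≤ 1 ∧ ContDiff ℝ ∞ e ∧ ContDiff ℝ ∞ e.symm ∧
      (∀ x t, (e (x, t)).2 = t) ∧ (∀ x ∉ Metric.closedBall c ρ', ∀ t, e (x, t) = (x, t)) ∧
      (∀ x, e (x, 0) = (x, 0)) ∧ ∀ x ∈ Metric.closedBall c ρ, (e (x, 1)).1 = x + s • (y - x) := by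
  let χ : ContDiffBump c := ⟨ρ, ρ', hρ, hρ'⟩
  -- The time profile is a bump function with `σ 0 = 0` and `σ 1 = 1`, which makes the vector field
  -- on `E × ℝ` compactly supported.
  let σ : ContDiffBump (1 : ℝ) := ⟨1 / 4, 1 / 2, by norm_num, by norm_num⟩
  let Y : E × ℝ → E × ℝ := fun p => ((σ p.2 * χ p.1) • (y - p.1), 0)
  have hχ0 : ∀ x ∉ Metric.closedBall c ρ', χ x = 0 := fun x hx => by
    rw [Metric.mem_closedBall, not_le] at hx
    exact χ.zero_of_le_dist hx.le
  have hσ0 : σ 0 = 0 := σ.zero_of_le_dist (by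
    change (1 / 2 : ℝ) ≤ dist (0 : ℝ) 1
    rw [Real.dist_eq]; norm_num)
  have hσ1 : σ 1 = 1 := σ.one_of_mem_closedBall (Metric.mem_closedBall_self σ.rIn_pos.le)
  have hY : ContDiff ℝ ∞ Y :=
    (((σ.contDiff.comp contDiff_snd).mul (χ.contDiff.comp contDiff_fst)).smul
      (contDiff_const.sub contDiff_fst)).prodMk contDiff_const
  have hYc : HasCompactSupport Y := by
    refine HasCompactSupport.intro ((isCompact_closedBall c ρ').prod
      (isCompact_closedBall (1 : ℝ) (1 / 2))) ?_
    rintro ⟨x, t⟩ hxt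
    rw [Set.mem_prod, not_and_or] at hxt
    rcases hxt with hx | ht
    · simp [Y, hχ0 x hx]
    · rw [Metric.mem_closedBall, not_le] at ht
      have : σ t = 0 := σ.zero_of_le_dist ht.le
      simp [Y, this]
  obtain ⟨s₀, hs₀, h⟩ := exists_diffeo_id_add_smul hY hYc
  obtain ⟨e, he, hs, hs'⟩ := h (min s₀ 1) (by positivity) (min_le_left _ _)
  refine ⟨min s₀ 1, e, by positivity, min_le_right _ _, hs, hs', fun x t => ?_,
    fun x hx t => ?_, fun x => ?_, fun x hx => ?_⟩
  · simp [he, Y]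
  · simp [he, Y, hχ0 x hx]
  · simp [he, Y, hσ0]
  · have : χ x = 1 := χ.one_of_mem_closedBall hx
    simp [he, Y, hσ1, this]

end EuclideanContraction

/-! ### Cells and the homogeneity of the interior -/

section Cells

variable {n : ℕ} {H : Type*} [TopologicalSpace H]
  {I : ModelWithCorners ℝ (EuclideanSpace ℝ (Fin n)) H}
  {M : Type*} [TopologicalSpace M] [ChartedSpace H M] {r : WithTop ℕ∞}

/-- `f` is the end of an isotopy starting at the identity which is stationary outside a compact
subset of `Ω`. -/
def CompactlyIsotopicIn (Ω : Set M) (f : M ≃ₘ^r⟮I, I⟯ M) : Prop :=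
  ∃ A : Set M, IsCompact A ∧ A ⊆ Ω ∧ IsotopicIn A f

namespace CompactlyIsotopicIn

theorem one (Ω : Set M) : CompactlyIsotopicIn Ω (1 : M ≃ₘ^r⟮I, I⟯ M) :=
  ⟨∅, isCompact_empty, Set.empty_subset _, IsotopicIn.one _⟩

theorem mono {Ω Ω' : Set M} {f : M ≃ₘ^r⟮I, I⟯ M} (h : CompactlyIsotopicIn Ω f)
    (hΩ : Ω ⊆ Ω') : CompactlyIsotopicIn Ω' f :=
  let ⟨A, h1, h2, h3⟩ := h
  ⟨A, h1, h2.trans hΩ, h3⟩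

theorem mul {Ω : Set M} {f f' : M ≃ₘ^r⟮I, I⟯ M} (h : CompactlyIsotopicIn Ω f)
    (h' : CompactlyIsotopicIn Ω f') : CompactlyIsotopicIn Ω (f * f') :=
  let ⟨_, h1, h2, h3⟩ := h
  let ⟨_, h1', h2', h3'⟩ := h'
  ⟨_, h1.union h1', Set.union_subset h2 h2',
    (h3.mono Set.subset_union_left).mul (h3'.mono Set.subset_union_right)⟩

theorem pow {Ω : Set M} {f : M ≃ₘ^r⟮I, I⟯ M} (h : CompactlyIsotopicIn Ω f) (m : ℕ) :
    CompactlyIsotopicIn Ω (f ^ m) := by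
  induction m with
  | zero => rw [pow_zero]; exact one Ω
  | succ m ih => rw [pow_succ]; exact ih.mul h

theorem apply_eq_self {Ω : Set M} {f : M ≃ₘ^r⟮I, I⟯ M} (h : CompactlyIsotopicIn Ω f) {x : M}
    (hx : x ∉ Ω) : f x = x :=
  let ⟨_, _, h2, h3⟩ := h
  h3.apply_eq_self fun hxA => hx (h2 hxA)

theorem apply_mem {Ω : Set M} {f : M ≃ₘ^r⟮I, I⟯ M} (h : CompactlyIsotopicIn Ω f) {x : M}
    (hx : x ∈ Ω) : f x ∈ Ω := by
  by_contra hcon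
  exact hcon ((f.injective (h.apply_eq_self hcon)).symm ▸ hx)

end CompactlyIsotopicIn

variable (I r) in
/-- A cell is an open set `G` in which every compact subset can be moved into every nonempty open
subset by an isotopy supported in a compact subset of `G`. -/
def IsCell (G : Set M) : Prop :=
  IsOpen G ∧ ∀ C : Set M, IsCompact C → C ⊆ G → ∀ W : Set M, IsOpen W → (W ∩ G).Nonempty →
    ∃ f : M ≃ₘ^r⟮I, I⟯ M, CompactlyIsotopicIn G f ∧ ∀ x ∈ C, f x ∈ W

/-- Coordinate balls are cells: iterate a contraction towards a point of the target. -/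
theorem isCell_image_ball [T2Space M] (hr : r ≤ ∞)
    {φ : OpenPartialHomeomorph (EuclideanSpace ℝ (Fin n)) M}
    (hφ : ContMDiffOn (𝓡 n) I r φ φ.source) (hφ' : ContMDiffOn I (𝓡 n) r φ.symm φ.target)
    {c : EuclideanSpace ℝ (Fin n)} {R : ℝ} (hR : 0 < R) (hball : Metric.ball c R ⊆ φ.source) :
    IsCell I r (φ '' Metric.ball c R) := by
  refine ⟨φ.isOpen_image_of_subset_source Metric.isOpen_ball hball, fun C hC hCG W hW hWG => ?_⟩
  obtain ⟨_, hyW, y, hy, rfl⟩ := hWG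
  have hGt : φ '' Metric.ball c R ⊆ φ.target := by
    rintro _ ⟨x, hx, rfl⟩
    exact φ.map_source (hball hx)
  have hC' : IsCompact (φ.symm '' C) :=
    hC.image_of_continuousOn (φ.symm.continuousOn.mono (hCG.trans hGt))
  have hCball : φ.symm '' C ⊆ Metric.ball c R := by
    rintro _ ⟨_, hm, rfl⟩
    obtain ⟨x, hx, rfl⟩ := hCG hm
    rwa [φ.left_inv (hball hx)]
  obtain ⟨ρ, ⟨hρ, hρR⟩, hsub⟩ := exists_pos_lt_subset_ball hR
    (hC'.union isCompact_singleton).isClosed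
    (Set.union_subset hCball (Set.singleton_subset_iff.2 hy))
  have hyρ : y ∈ Metric.closedBall c ρ := Metric.ball_subset_closedBall (hsub (Or.inr rfl))
  have hρ' : ρ < (ρ + R) / 2 := by linarith
  have hρ'R : (ρ + R) / 2 < R := by linarith
  obtain ⟨s, e, hs, hs1, he, he', hlevel, hfix, hzero, hone⟩ := exists_contraction
    (c := c) (y := y) hρ hρ'
  have hK : Metric.closedBall c ((ρ + R) / 2) ⊆ Metric.ball c R :=
    Metric.closedBall_subset_ball hρ'R
  obtain ⟨F, hF, hFe⟩ := exists_transport_isIsotopyIn hr hφ hφ' (isCompact_closedBall _ _)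
    (hK.trans hball) e he he' hlevel hfix hzero
  obtain ⟨f, hf⟩ := hF.1.exists_endsAt
  have hfG : CompactlyIsotopicIn (φ '' Metric.ball c R) f :=
    ⟨_, (isCompact_closedBall _ _).image_of_continuousOn (φ.continuousOn.mono (hK.trans hball)),
      Set.image_mono hK, F, hF, hf⟩
  have hρs : Metric.closedBall c ρ ⊆ φ.source := (Metric.closedBall_subset_ball hρR).trans hball
  have hfφ : ∀ x ∈ Metric.closedBall c ρ, f (φ x) = φ (x + s • (y - x)) := by
    intro x hx
    have h1 := hf (φ x)
    rw [hFe x (hρs hx)] at h1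
    rw [← hone x hx]
    exact (Prod.ext_iff.1 h1).1.symm
  have hstay : ∀ x ∈ Metric.closedBall c ρ, ∀ u : ℝ, 0 ≤ u → u ≤ 1 →
      y + u • (x - y) ∈ Metric.closedBall c ρ := by
    intro x hx u hu0 hu1
    have := (convex_closedBall c ρ).add_smul_sub_mem hyρ hx ⟨hu0, hu1⟩
    exact this
  have hs0' : (0 : ℝ) ≤ 1 - s := by linarith
  have hs1' : 1 - s < 1 := by linarith
  have hiter : ∀ (m : ℕ), ∀ x ∈ Metric.closedBall c ρ,
      (f ^ m) (φ x) = φ (y + (1 - s) ^ m • (x - y)) := by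
    intro m x hx
    induction m with
    | zero =>
      rw [pow_zero, pow_zero, one_smul, add_sub_cancel]
      rfl
    | succ m ih =>
      rw [pow_succ']
      change f ((f ^ m) (φ x)) = _
      rw [ih, hfφ _ (hstay x hx _ (pow_nonneg hs0' m) (pow_le_one₀ hs0' hs1'.le))]
      congr 1
      rw [pow_succ]
      module
  have hWnhds : φ.source ∩ φ ⁻¹' W ∈ 𝓝 y :=
    (φ.isOpen_inter_preimage hW).mem_nhds ⟨hρs hyρ, hyW⟩
  obtain ⟨ε, hε, hεW⟩ := Metric.mem_nhds_iff.1 hWnhds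
  obtain ⟨m, hm⟩ := exists_pow_lt_of_lt_one (show 0 < ε / (2 * ρ) by positivity) hs1'
  refine ⟨f ^ m, hfG.pow m, ?_⟩
  intro z hz
  obtain ⟨x, hx, rfl⟩ := hCG hz
  have hxρ : x ∈ Metric.closedBall c ρ := Metric.ball_subset_closedBall
    (hsub (Or.inl ⟨φ x, hz, φ.left_inv (hball hx)⟩))
  rw [hiter m x hxρ]
  refine (hεW ?_).2
  have hdist : ‖x - y‖ ≤ 2 * ρ := by
    rw [← dist_eq_norm]
    linarith [dist_triangle_right x y c, Metric.mem_closedBall.1 hxρ, Metric.mem_closedBall.1 hyρ]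
  rw [Metric.mem_ball, dist_eq_norm, add_sub_cancel_left, norm_smul, Real.norm_eq_abs,
    abs_of_nonneg (pow_nonneg hs0' m)]
  calc (1 - s) ^ m * ‖x - y‖ ≤ (1 - s) ^ m * (2 * ρ) :=
        mul_le_mul_of_nonneg_left hdist (pow_nonneg hs0' m)
    _ < ε := by rwa [lt_div_iff₀ (by positivity)] at hm

section Manifold

variable [IsManifold I ∞ M]

/-- The inverse of the preferred chart at an interior point, as an open partial homeomorphism from
the model space. -/
theorem exists_interior_chart (hr : r ≤ ∞) {x : M} (hx : x ∈ I.interior M) :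
    ∃ φ : OpenPartialHomeomorph (EuclideanSpace ℝ (Fin n)) M,
      ContMDiffOn (𝓡 n) I r φ φ.source ∧ ContMDiffOn I (𝓡 n) r φ.symm φ.target ∧
      x ∈ φ.target := by
  have : IsManifold I r M := IsManifold.of_le hr
  let e := extChartAt I x
  have hU : interior e.target ⊆ e.target := interior_subset
  refine ⟨⟨⟨⟨e.symm, e, interior e.target, (chartAt H x).source ∩ e ⁻¹' interior e.target,
    ?_, ?_, ?_, ?_⟩, ?_, ?_⟩, isOpen_interior, isOpen_extChartAt_preimage x isOpen_interior⟩,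
    ?_, ?_, ?_⟩
  · intro z hz
    refine ⟨?_, ?_⟩
    · rw [← extChartAt_source I x]
      exact e.map_target (hU hz)
    · change e (e.symm z) ∈ interior e.target
      rwa [e.right_inv (hU hz)]
  · exact fun y hy => hy.2
  · exact fun z hz => e.right_inv (hU hz)
  · intro y hy
    refine e.left_inv ?_
    rw [extChartAt_source]
    exact hy.1
  · exact (continuousOn_extChartAt_symm x).mono hU
  · exact (continuousOn_extChartAt x).mono
      (Set.inter_subset_left.trans (extChartAt_source I x).ge)
  · exact (contMDiffOn_extChartAt_symm x).mono hU
  · exact contMDiffOn_extChartAt.mono Set.inter_subset_left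
  · exact ⟨mem_chart_source H x, I.isInteriorPoint_iff.1 hx⟩

/-- Cells form a basis of the topology of the interior. -/
theorem exists_isCell_subset [T2Space M] (hr : r ≤ ∞) {x : M} (hx : x ∈ I.interior M)
    {Ω : Set M} (hΩ : Ω ∈ 𝓝 x) : ∃ G : Set M, IsCell I r G ∧ x ∈ G ∧ G ⊆ Ω := by
  obtain ⟨φ, hφ, hφ', hxφ⟩ := exists_interior_chart (r := r) hr hx
  have hnhds : φ.source ∩ φ ⁻¹' Ω ∈ 𝓝 (φ.symm x) := by
    refine Filter.inter_mem (φ.open_source.mem_nhds (φ.map_target hxφ)) ?_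
    refine (φ.continuousAt (φ.map_target hxφ)).preimage_mem_nhds ?_
    rwa [φ.right_inv hxφ]
  obtain ⟨R, hR, hsub⟩ := Metric.mem_nhds_iff.1 hnhds
  refine ⟨_, isCell_image_ball hr hφ hφ' hR fun z hz => (hsub hz).1,
    ⟨φ.symm x, Metric.mem_ball_self hR, φ.right_inv hxφ⟩, ?_⟩
  rintro _ ⟨z, hz, rfl⟩
  exact (hsub hz).2

/-- If a finite set `F` can be moved into one cell of a connected open subset `Ω` of the interior,
then it can be moved into every nonempty open subset of `Ω`. -/
theorem exists_move_of_move_into_cell [T2Space M] (hr : r ≤ ∞) {Ω F G J : Set M} (hΩ : IsOpen Ω)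
    (hΩI : Ω ⊆ I.interior M) (hΩc : IsPreconnected Ω) (hF : F.Finite) (hG : IsCell I r G)
    (hGΩ : G ⊆ Ω) (hGne : G.Nonempty)
    (hFG : ∃ f : M ≃ₘ^r⟮I, I⟯ M, CompactlyIsotopicIn Ω f ∧ ∀ x ∈ F, f x ∈ G)
    (hJ : IsOpen J) (hJΩ : (J ∩ Ω).Nonempty) :
    ∃ f : M ≃ₘ^r⟮I, I⟯ M, CompactlyIsotopicIn Ω f ∧ ∀ x ∈ F, f x ∈ J := by
  have cell_step : ∀ G : Set M, IsCell I r G → G ⊆ Ω →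
      (∃ f : M ≃ₘ^r⟮I, I⟯ M, CompactlyIsotopicIn Ω f ∧ ∀ x ∈ F, f x ∈ G) →
      ∀ J : Set M, IsOpen J → (J ∩ G).Nonempty →
      ∃ f : M ≃ₘ^r⟮I, I⟯ M, CompactlyIsotopicIn Ω f ∧ ∀ x ∈ F, f x ∈ J := by
    rintro G hG hGΩ ⟨f, hf, hfG⟩ J hJ hJG
    obtain ⟨f', hf', hfJ⟩ := hG.2 (f '' F) (hF.image f).isCompact
      (by rintro _ ⟨x, hx, rfl⟩; exact hfG x hx) J hJ hJG
    exact ⟨f' * f, (hf'.mono hGΩ).mul hf, fun x hx => hfJ _ ⟨x, hx, rfl⟩⟩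
  let A : Set M := {y | y ∈ Ω ∧ ∀ J : Set M, IsOpen J → y ∈ J →
    ∃ f : M ≃ₘ^r⟮I, I⟯ M, CompactlyIsotopicIn Ω f ∧ ∀ x ∈ F, f x ∈ J}
  have hGA : ∀ G : Set M, IsCell I r G → G ⊆ Ω →
      (∃ f : M ≃ₘ^r⟮I, I⟯ M, CompactlyIsotopicIn Ω f ∧ ∀ x ∈ F, f x ∈ G) → G ⊆ A :=
    fun G hG hGΩ hfG y hy => ⟨hGΩ hy, fun J hJ hyJ => cell_step G hG hGΩ hfG J hJ ⟨y, hyJ, hy⟩⟩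
  have hAo : IsOpen A := by
    rw [isOpen_iff_mem_nhds]
    rintro y ⟨hyΩ, hy⟩
    obtain ⟨G, hG, hyG, hGΩ⟩ := exists_isCell_subset (r := r) hr (hΩI hyΩ) (hΩ.mem_nhds hyΩ)
    exact Filter.mem_of_superset (hG.1.mem_nhds hyG) (hGA G hG hGΩ (hy G hG.1 hyG))
  have hsub : Ω ⊆ A := by
    refine hΩc.subset_of_closure_inter_subset hAo ?_ ?_
    · obtain ⟨y, hy⟩ := hGne
      exact ⟨y, hGΩ hy, hGA G hG hGΩ hFG hy⟩
    · rintro y ⟨hy, hyΩ⟩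
      obtain ⟨G, hG, hyG, hGΩ⟩ := exists_isCell_subset (r := r) hr (hΩI hyΩ) (hΩ.mem_nhds hyΩ)
      obtain ⟨z, hzG, hz⟩ := mem_closure_iff.1 hy G hG.1 hyG
      exact hGA G hG hGΩ (hz.2 G hG.1 hzG) hyG
  obtain ⟨y, hyJ, hyΩ⟩ := hJΩ
  exact (hsub hyΩ).2 J hJ hyJ

theorem exists_move_point [T2Space M] (hr : r ≤ ∞) {Ω J : Set M} {p : M} (hΩ : IsOpen Ω)
    (hΩI : Ω ⊆ I.interior M) (hΩc : IsPreconnected Ω) (hp : p ∈ Ω) (hJ : IsOpen J)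
    (hJΩ : (J ∩ Ω).Nonempty) :
    ∃ f : M ≃ₘ^r⟮I, I⟯ M, CompactlyIsotopicIn Ω f ∧ f p ∈ J := by
  obtain ⟨G, hG, hpG, hGΩ⟩ := exists_isCell_subset (r := r) hr (hΩI hp) (hΩ.mem_nhds hp)
  obtain ⟨f, hf, hfJ⟩ := exists_move_of_move_into_cell hr hΩ hΩI hΩc (Set.finite_singleton p) hG
    hGΩ ⟨p, hpG⟩ ⟨1, CompactlyIsotopicIn.one Ω, by rintro _ rfl; exact hpG⟩ hJ hJΩ
  exact ⟨f, hf, hfJ p rfl⟩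

/-- A finite subset of a connected open subset `Ω` of the interior can be moved into any nonempty
open subset of `Ω`. No paths avoiding the other points are needed, so that the argument also covers
dimension one. -/
theorem exists_move_finite [T2Space M] [LocallyCompactSpace M] [LocallyConnectedSpace M]
    (hr : r ≤ ∞) {Ω F J : Set M} (hΩ : IsOpen Ω)
    (hΩI : Ω ⊆ I.interior M) (hΩc : IsPreconnected Ω) (hF : F.Finite) (hFΩ : F ⊆ Ω)
    (hJ : IsOpen J) (hJΩ : (J ∩ Ω).Nonempty) :
    ∃ f : M ≃ₘ^r⟮I, I⟯ M, CompactlyIsotopicIn Ω f ∧ ∀ x ∈ F, f x ∈ J := by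
  induction F, hF using Set.Finite.induction_on generalizing J with
  | empty => exact ⟨1, CompactlyIsotopicIn.one Ω, fun x hx => absurd hx (Set.notMem_empty x)⟩
  | @insert p F _ hF ih =>
    have hp : p ∈ Ω := hFΩ (Set.mem_insert p F)
    have hFΩ' : F ⊆ Ω := (Set.subset_insert p F).trans hFΩ
    obtain ⟨G, hG, hpG, hGΩ⟩ := exists_isCell_subset (r := r) hr (hΩI hp) (hΩ.mem_nhds hp)
    refine exists_move_of_move_into_cell hr hΩ hΩI hΩc (hF.insert p) hG hGΩ ⟨p, hpG⟩ ?_ hJ hJΩ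
    -- `F` is moved into a compact subset `K` of `G`, and then the last point is moved into `G`
    -- without touching `K`.
    obtain ⟨K, hK, hpK, hKG⟩ := exists_compact_subset hG.1 hpG
    obtain ⟨f, hf, hfK⟩ := ih hFΩ' isOpen_interior ⟨p, hpK, hp⟩
    by_cases hq : f p ∈ K
    · refine ⟨f, hf, fun x hx => ?_⟩
      rcases Set.mem_insert_iff.1 hx with rfl | hx
      · exact hKG hq
      · exact hKG (interior_subset (hfK x hx))
    have hΩK : IsOpen (Ω \ K) := hΩ.sdiff hK.isClosed
    have hqΩ : f p ∈ Ω \ K := ⟨hf.apply_mem hp, hq⟩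
    set C := connectedComponentIn (Ω \ K) (f p) with hC
    have hCsub : C ⊆ Ω \ K := connectedComponentIn_subset _ _
    have hqC : f p ∈ C := mem_connectedComponentIn hqΩ
    have hCo : IsOpen C := hΩK.connectedComponentIn
    have hCG : (G ∩ C).Nonempty := by
      by_contra hcon
      have hsub : Ω ⊆ C := by
        refine hΩc.subset_of_closure_inter_subset hCo ⟨f p, hqΩ.1, hqC⟩ ?_
        rintro y ⟨hy, hyΩ⟩
        by_cases hyK : y ∈ K
        · exact absurd (mem_closure_iff.1 hy G hG.1 (hKG hyK)) hcon
        · have hyΩK : y ∈ Ω \ K := ⟨hyΩ, hyK⟩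
          obtain ⟨z, hzy, hzC⟩ := mem_closure_iff.1 hy _ (hΩK.connectedComponentIn (x := y))
            (mem_connectedComponentIn hyΩK)
          rw [hC, connectedComponentIn_eq hzC, ← connectedComponentIn_eq hzy]
          exact mem_connectedComponentIn hyΩK
      exact hcon ⟨p, hpG, hsub hp⟩
    obtain ⟨f', hf', hf'G⟩ := exists_move_point (r := r) hr hCo
      ((hCsub.trans Set.sdiff_subset).trans hΩI) isPreconnected_connectedComponentIn hqC hG.1 hCG
    refine ⟨f' * f, (hf'.mono (hCsub.trans Set.sdiff_subset)).mul hf, fun x hx => ?_⟩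
    change f' (f x) ∈ G
    rcases Set.mem_insert_iff.1 hx with rfl | hx
    · exact hf'G
    · have hxK := interior_subset (hfK x hx)
      rw [hf'.apply_eq_self fun hxC => (hCsub hxC).2 hxK]
      exact hKG hxK

variable (I M)

/-- Every point has arbitrarily small connected neighbourhoods whose interior points form a nonempty
connected set: in a chart, intersect the model with a ball. -/
theorem exists_nhds_preconnected_interior {x : M} {W : Set M} (hW : W ∈ 𝓝 x) :
    ∃ V : Set M, IsOpen V ∧ x ∈ V ∧ V ⊆ W ∧ IsPreconnected V ∧
      IsPreconnected (V ∩ I.interior M) ∧ (V ∩ I.interior M).Nonempty := by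
  let e := extChartAt I x
  have hnhds : e.target ∩ e.symm ⁻¹' W ∈ 𝓝[Set.range I] (e x) := by
    refine Filter.inter_mem (extChartAt_target_mem_nhdsWithin x) ?_
    have := extChartAt_preimage_mem_nhdsWithin (I := I) (x := x) (s := Set.univ)
      (mem_nhdsWithin_of_mem_nhds hW)
    rwa [Set.preimage_univ, Set.univ_inter] at this
  obtain ⟨R, hR, hsub⟩ := Metric.mem_nhdsWithin_iff.1 hnhds
  set B := Metric.ball (e x) R with hB
  have hBt : B ∩ Set.range I ⊆ e.target := fun z hz => (hsub hz).1
  have hBint : B ∩ interior (Set.range I) ⊆ interior e.target :=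
    interior_maximal ((Set.inter_subset_inter_right _ interior_subset).trans hBt)
      (Metric.isOpen_ball.inter isOpen_interior)
  have hVeq : (chartAt H x).source ∩ e ⁻¹' B = e.symm '' (B ∩ Set.range I) := by
    ext y
    constructor
    · rintro ⟨hy, hyB⟩
      rw [← extChartAt_source I x] at hy
      exact ⟨e y, ⟨hyB, extChartAt_target_subset_range x (e.map_source hy)⟩, e.left_inv hy⟩
    · rintro ⟨z, hz, rfl⟩
      refine ⟨?_, ?_⟩
      · rw [← extChartAt_source I x]
        exact e.map_target (hBt hz)
      · rw [Set.mem_preimage, e.right_inv (hBt hz)]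
        exact hz.1
  have hiff : ∀ y ∈ (chartAt H x).source, y ∈ I.interior M ↔ e y ∈ interior e.target := fun y hy =>
    I.isInteriorPoint_iff_of_mem_atlas (n := ∞) (by simp) (chart_mem_atlas H x) hy
  have hVint : (chartAt H x).source ∩ e ⁻¹' B ∩ I.interior M =
      e.symm '' (B ∩ interior (Set.range I)) := by
    ext y
    constructor
    · rintro ⟨⟨hy, hyB⟩, hyI⟩
      refine ⟨e y, ⟨hyB, ?_⟩, e.left_inv ((extChartAt_source I x).symm ▸ hy)⟩
      exact interior_mono (extChartAt_target_subset_range x) ((hiff y hy).1 hyI)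
    · rintro ⟨z, hz, rfl⟩
      have hzt : z ∈ e.target := interior_subset (hBint hz)
      have hzV : e.symm z ∈ (chartAt H x).source ∩ e ⁻¹' B :=
        hVeq ▸ ⟨z, ⟨hz.1, interior_subset hz.2⟩, rfl⟩
      refine ⟨hzV, (hiff _ hzV.1).2 ?_⟩
      rw [e.right_inv hzt]
      exact hBint hz
  have hconv := I.convex_range
  refine ⟨(chartAt H x).source ∩ e ⁻¹' B, isOpen_extChartAt_preimage x Metric.isOpen_ball,
    ⟨mem_chart_source H x, Metric.mem_ball_self hR⟩, ?_, ?_, ?_, ?_⟩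
  · rw [hVeq]
    rintro _ ⟨z, hz, rfl⟩
    exact (hsub hz).2
  · rw [hVeq]
    exact ((convex_ball _ _).inter hconv).isPreconnected.image _
      ((continuousOn_extChartAt_symm x).mono hBt)
  · rw [hVint]
    exact ((convex_ball _ _).inter hconv.interior).isPreconnected.image _
      ((continuousOn_extChartAt_symm x).mono (hBint.trans interior_subset))
  · rw [hVint]
    refine Set.Nonempty.image _ ?_
    exact mem_closure_iff.1 (I.range_subset_closure_interior
      (extChartAt_target_subset_range x (mem_extChartAt_target x))) _ Metric.isOpen_ball
      (Metric.mem_ball_self hR)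

theorem locallyConnectedSpace_of_isManifold
    (J : ModelWithCorners ℝ (EuclideanSpace ℝ (Fin n)) H) [IsManifold J ∞ M] :
    LocallyConnectedSpace M := by
  rw [locallyConnectedSpace_iff_subsets_isOpen_isConnected]
  intro x U hU
  obtain ⟨V, hVo, hxV, hVU, hVc, -⟩ := exists_nhds_preconnected_interior J M hU
  exact ⟨V, hVU, hVo, hxV, ⟨x, hxV⟩, hVc⟩

theorem dense_interior : Dense (I.interior M) := by
  rw [dense_iff_inter_open]
  rintro U hU ⟨x, hx⟩
  obtain ⟨V, -, -, hVU, -, -, hV⟩ := exists_nhds_preconnected_interior I M (hU.mem_nhds hx)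
  exact hV.mono (Set.inter_subset_inter_left _ hVU)

variable {I M}

/-- Removing the boundary does not disconnect an open set. -/
theorem isPreconnected_inter_interior {O : Set M} (hO : IsOpen O) (hc : IsPreconnected O) :
    IsPreconnected (O ∩ I.interior M) := by
  rw [isPreconnected_iff_subset_of_disjoint]
  intro u v hu hv huv hdisj
  let w : Set M → Set M := fun u => ⋃₀ {V | IsOpen V ∧ V ⊆ O ∧ V ∩ I.interior M ⊆ u}
  have hwo : ∀ u, IsOpen (w u) := fun u => isOpen_sUnion fun V hV => hV.1
  have hwu : ∀ u, O ⊆ w u → O ∩ I.interior M ⊆ u := by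
    rintro u hOu x ⟨hxO, hxI⟩
    obtain ⟨V, hV, hxV⟩ := hOu hxO
    exact hV.2.2 ⟨hxV, hxI⟩
  have hcov : O ⊆ w u ∪ w v := by
    intro x hx
    obtain ⟨V, hVo, hxV, hVO, -, hVc, -⟩ :=
      exists_nhds_preconnected_interior I M (hO.mem_nhds hx)
    have hVsub := Set.inter_subset_inter_left (I.interior M) hVO
    rcases isPreconnected_iff_subset_of_disjoint.1 hVc u v hu hv (hVsub.trans huv)
      (Set.subset_empty_iff.1 (hdisj ▸ Set.inter_subset_inter_left _ hVsub)) with h | h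
    · exact Or.inl ⟨V, ⟨hVo, hVO, h⟩, hxV⟩
    · exact Or.inr ⟨V, ⟨hVo, hVO, h⟩, hxV⟩
  have hwdisj : O ∩ (w u ∩ w v) = ∅ := by
    rw [Set.eq_empty_iff_forall_notMem]
    rintro x ⟨-, ⟨V, hV, hxV⟩, V', hV', hxV'⟩
    obtain ⟨y, ⟨hyV, hyV'⟩, hyI⟩ := (dense_interior I M).inter_open_nonempty _
      (hV.1.inter hV'.1) ⟨x, hxV, hxV'⟩
    have : y ∈ O ∩ I.interior M ∩ (u ∩ v) :=
      ⟨⟨hV.2.1 hyV, hyI⟩, hV.2.2 ⟨hyV, hyI⟩, hV'.2.2 ⟨hyV', hyI⟩⟩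
    rw [hdisj] at this
    exact this
  exact (isPreconnected_iff_subset_of_disjoint.1 hc _ _ (hwo u) (hwo v) hcov hwdisj).imp
    (hwu u) (hwu v)

end Manifold

end Cells

/-! ### Choosing points displaced by a permutation -/

section Selection

/-- From infinite sets `T i` on which the permutation `g` has no fixed points one can choose points
none of which is mapped by `g` to another of them. -/
theorem exists_selection_displaced {ι X : Type*} [Countable ι] {T : ι → Set X}
    (hT : ∀ i, (T i).Infinite) (g : X ≃ X) (hg : ∀ i, ∀ x ∈ T i, g x ≠ x) :
    ∃ s : ι → X, (∀ i, s i ∈ T i) ∧ ∀ i j, g (s i) ≠ s j := by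
  obtain ⟨c, hc⟩ := exists_injective_nat ι
  have wf : WellFounded fun j i => c j < c i := (measure c).wf
  have step : ∀ (i : ι) (prev : ∀ j, c j < c i → X), ∃ x ∈ T i,
      ∀ j h, x ≠ g (prev j h) ∧ x ≠ g.symm (prev j h) := by
    intro i prev
    have hfin : Finite {j // c j < c i} :=
      ((Set.finite_Iio (c i)).preimage hc.injOn).to_subtype
    obtain ⟨x, hx, hx'⟩ := ((hT i).sdiff ((Set.finite_range fun j : {j // c j < c i} =>
      g (prev j.1 j.2)).union (Set.finite_range fun j : {j // c j < c i} =>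
      g.symm (prev j.1 j.2)))).nonempty
    refine ⟨x, hx, fun j h => ⟨?_, ?_⟩⟩
    · rintro rfl; exact hx' (Or.inl ⟨⟨j, h⟩, rfl⟩)
    · rintro rfl; exact hx' (Or.inr ⟨⟨j, h⟩, rfl⟩)
  choose next hnext hprev using step
  let s : ι → X := wf.fix next
  have hs : ∀ i, s i = next i fun j _ => s j := fun i => wf.fix_eq next i
  have hsT : ∀ i, s i ∈ T i := fun i => by rw [hs]; exact hnext _ _
  have hlt : ∀ i j, c j < c i → s i ≠ g (s j) ∧ s i ≠ g.symm (s j) := fun i j h => by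
    have := hprev i (fun j _ => s j) j h
    rwa [← hs] at this
  refine ⟨s, hsT, fun i j heq => ?_⟩
  rcases lt_trichotomy (c i) (c j) with h | h | h
  · exact (hlt j i h).1 heq.symm
  · rw [hc h] at heq
    exact hg j _ (hsT j) heq
  · exact (hlt i j h).2 (by rw [← heq, g.symm_apply_apply])

end Selection

/-! ### Locally finite and discrete families -/

section PieceFamily

variable {X : Type*} [TopologicalSpace X] {P S : Set X} {𝒪 : Set (Set X)}

theorem IsPieceFamily.locallyFinite_of_subset (h : IsPieceFamily P S 𝒪) {A : 𝒪 → Set X}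
    (hA : ∀ O, A O ⊆ O.1) : LocallyFinite A := by
  intro x
  obtain ⟨U, hU, hfin⟩ := h.locallyFinite x
  refine ⟨U, hU, Set.Finite.of_finite_image (f := Subtype.val) (hfin.subset ?_)
    Subtype.val_injective.injOn⟩
  rintro _ ⟨O, hO, rfl⟩
  exact ⟨O.2, hO.mono (Set.inter_subset_inter_left _ (hA O))⟩

theorem IsDiscreteCollection.locallyFinite {𝓕 : Set (Set X)} (h : IsDiscreteCollection 𝓕)
    {A : 𝓕 → Set X} (hA : ∀ B, A B ⊆ B.1) : LocallyFinite A := by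
  intro x
  obtain ⟨U, hU, hsub⟩ := h x
  refine ⟨U, hU, Set.Finite.of_finite_image (f := Subtype.val) (hsub.finite.subset ?_)
    Subtype.val_injective.injOn⟩
  rintro _ ⟨B, ⟨y, hyA, hyU⟩, rfl⟩
  exact ⟨B.2, y, hyU, hA B hyA⟩

theorem IsDiscreteCollection.eq_of_mem {𝓕 : Set (Set X)} (h : IsDiscreteCollection 𝓕)
    {B B' : Set X} (hB : B ∈ 𝓕) (hB' : B' ∈ 𝓕) {x : X} (hx : x ∈ B) (hx' : x ∈ B') : B = B' := by
  obtain ⟨U, hU, hsub⟩ := h x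
  exact hsub ⟨hB, x, mem_of_mem_nhds hU, hx⟩ ⟨hB', x, mem_of_mem_nhds hU, hx'⟩

theorem isDiscreteCollection_of_finite {𝓕 : Set (Set X)} (hfin : 𝓕.Finite)
    (hcl : ∀ B ∈ 𝓕, IsClosed B) (hdisj : 𝓕.PairwiseDisjoint id) : IsDiscreteCollection 𝓕 := by
  intro x
  have hclosed : IsClosed (⋃ B ∈ {B ∈ 𝓕 | x ∉ B}, B) :=
    (hfin.subset fun B hB => hB.1).isClosed_biUnion fun B hB => hcl B hB.1
  refine ⟨_, hclosed.isOpen_compl.mem_nhds ?_, ?_⟩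
  · rw [Set.mem_compl_iff, Set.mem_iUnion₂]
    rintro ⟨B, hB, hx⟩
    exact hB.2 hx
  · have key : ∀ B ∈ 𝓕, ((⋃ B ∈ {B ∈ 𝓕 | x ∉ B}, B)ᶜ ∩ B).Nonempty → x ∈ B := by
      rintro B hB ⟨y, hy, hyB⟩
      by_contra hx
      exact hy (Set.mem_biUnion (show B ∈ {B ∈ 𝓕 | x ∉ B} from ⟨hB, hx⟩) hyB)
    rintro B ⟨hB, hBne⟩ B' ⟨hB', hBne'⟩
    exact hdisj.elim_set hB hB' x (key B hB hBne) (key B' hB' hBne')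

end PieceFamily

variable {n : ℕ} {H : Type*} [TopologicalSpace H]
  {I : ModelWithCorners ℝ (EuclideanSpace ℝ (Fin n)) H}
  {M : Type*} [TopologicalSpace M] [ChartedSpace H M] {r : WithTop ℕ∞}

/-! ### End diffeomorphisms of isotopies -/

section Ends

/-- Simultaneous isotopy along a locally finite family of disjoint closed sets, on the level of
end diffeomorphisms. -/
theorem exists_glue_isotopicIn {ι : Type*} {A : ι → Set M} {f : ι → M ≃ₘ^r⟮I, I⟯ M}
    (hf : ∀ i, IsotopicIn (A i) (f i)) (hcl : ∀ i, IsClosed (A i))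
    (hlf : LocallyFinite A) (hdisj : Pairwise fun i j => Disjoint (A i) (A j)) :
    ∃ f' : M ≃ₘ^r⟮I, I⟯ M, IsotopicIn (⋃ i, A i) f' ∧
      ∀ i x, (∀ j, j ≠ i → x ∉ A j) → f' x = f i x := by
  choose F hF hFf using hf
  obtain ⟨F', hF', hF'F⟩ := exists_glue_isIsotopyIn hF hcl hlf hdisj
  obtain ⟨f', hf'⟩ := hF'.1.exists_endsAt
  have hiso : IsotopicIn (⋃ i, A i) f' := ⟨F', hF', hf'⟩
  refine ⟨f', hiso, fun i x hx => ?_⟩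
  by_cases hxi : x ∈ A i
  · have h1 := hf' x
    rw [hF'F i x hxi, hFf] at h1
    exact (Prod.ext_iff.1 h1).1.symm
  · rw [hiso.apply_eq_self, IsotopicIn.apply_eq_self ⟨F i, hF i, hFf i⟩ hxi]
    rw [Set.mem_iUnion]
    rintro ⟨j, hj⟩
    by_cases hji : j = i
    · exact hxi (hji ▸ hj)
    · exact hx j hji hj

theorem IsotopicIn.mem_diffZero {A : Set M} {f : M ≃ₘ^r⟮I, I⟯ M} (h : IsotopicIn A f)
    (hA : IsClosed A) (hAI : A ⊆ I.interior M) : f ∈ DiffZero I r (I.boundary M) :=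
  let ⟨F, hF, hf⟩ := h
  ⟨F, hF.isIsotopyRel hA hAI, hf⟩

theorem IsotopicIn.mem_diffCompactZero [T2Space M] {A : Set M} {f : M ≃ₘ^r⟮I, I⟯ M}
    (h : IsotopicIn A f) (hA : IsCompact A) (hAI : A ⊆ I.interior M) :
    f ∈ DiffCompactZero I r (I.boundary M) :=
  let ⟨F, hF, hf⟩ := h
  ⟨F, hF.isIsotopyRel hA.isClosed hAI, ⟨A, hA, hF.2.2⟩, hf⟩

theorem diffZero_mono {C C' : Set M} (h : C ⊆ C') : DiffZero I r C' ≤ DiffZero I r C := by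
  rintro f ⟨F, ⟨h1, h2, U, hU, h3⟩, hf⟩
  exact ⟨F, ⟨h1, h2, U, nhdsSet_mono h hU, h3⟩, hf⟩

theorem diffZero_le_diffCompactZero {C C' K : Set M} (h : C ⊆ C') (hK : IsCompact K)
    (hC' : C'ᶜ ⊆ K) :
    DiffZero I r C' ≤ DiffCompactZero I r C := by
  rintro f ⟨F, ⟨h1, h2, U, hU, h3⟩, hf⟩
  refine ⟨F, ⟨h1, h2, U, nhdsSet_mono h hU, h3⟩, ⟨K, hK, fun x hx t => h3 x ?_ t⟩, hf⟩
  exact subset_of_mem_nhdsSet hU (Set.notMem_compl_iff.1 fun h => hx (hC' h))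

/-- Elements of `Diff^r(M, C)_0` are the identity on a neighbourhood of `C`. -/
theorem eqOn_nhdsSet_of_mem_diffZero {C : Set M} {f : M ≃ₘ^r⟮I, I⟯ M}
    (h : f ∈ DiffZero I r C) : ∃ U ∈ 𝓝ˢ C, ∀ x ∈ U, f x = x := by
  obtain ⟨F, ⟨h1, h2, U, hU, h3⟩, hf⟩ := h
  refine ⟨U, hU, fun x hx => ?_⟩
  have := hf x
  rw [h3 x hx] at this
  exact (Prod.ext_iff.1 this).1.symm

/-- An isotopy from the identity cannot move an isolated point. -/
theorem neBot_nhdsNE_of_mem_diffZero [T1Space M] {C : Set M} {f : M ≃ₘ^r⟮I, I⟯ M}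
    (h : f ∈ DiffZero I r C) {x : M} (hx : f x ≠ x) : (𝓝[≠] x).NeBot := by
  by_contra hcon
  rw [Filter.not_neBot, ← isOpen_singleton_iff_punctured_nhds] at hcon
  obtain ⟨F, ⟨-, h2, -⟩, hf⟩ := h
  have hcont : Continuous fun t : Set.Icc (0 : ℝ) 1 => (F (x, t)).1 :=
    continuous_fst.comp (F.continuous.comp (Continuous.prodMk_right x))
  have hconst : ∀ t : Set.Icc (0 : ℝ) 1, (F (x, t)).1 ∈ ({x} : Set M) := by
    have hclopen : IsClopen ((fun t : Set.Icc (0 : ℝ) 1 => (F (x, t)).1) ⁻¹' {x}) :=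
      IsClopen.preimage (s := {x}) ⟨isClosed_singleton, hcon⟩ hcont
    have huniv := hclopen.eq_univ ⟨0, by simp [h2]⟩
    exact fun t => huniv.ge (Set.mem_univ t)
  have := hconst 1
  rw [hf] at this
  exact hx this

end Ends

/-! ### Balls -/

section Balls

theorem IsBall.isCompact {B : Set M} (hB : IsBall I r B) : IsCompact B := by
  obtain ⟨φ, -, -, hs, -, rfl⟩ := hB
  exact (isCompact_closedBall _ _).image_of_continuousOn (φ.continuousOn.mono hs)

theorem IsBall.subset_interior {B : Set M} (hB : IsBall I r B) : B ⊆ I.interior M := by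
  obtain ⟨φ, -, -, hs, ht, rfl⟩ := hB
  rintro _ ⟨x, hx, rfl⟩
  exact ht (φ.map_source (hs hx))

/-- A ball contains a cell which contains its topological interior. -/
theorem IsBall.exists_isCell [T2Space M] (hr : r ≤ ∞) {B : Set M} (hB : IsBall I r B) :
    ∃ G : Set M, IsCell I r G ∧ G.Nonempty ∧ G ⊆ B ∧ interior B ⊆ G := by
  obtain ⟨φ, hφ, hφ', hs, -, rfl⟩ := hB
  have hball : Metric.ball (0 : EuclideanSpace ℝ (Fin n)) 1 ⊆ φ.source :=
    Metric.ball_subset_closedBall.trans hs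
  refine ⟨φ '' Metric.ball 0 1, isCell_image_ball hr hφ hφ' one_pos hball,
    ⟨φ 0, 0, Metric.mem_ball_self one_pos, rfl⟩, Set.image_mono Metric.ball_subset_closedBall, ?_⟩
  intro y hy
  obtain ⟨x, hx, rfl⟩ := interior_subset hy
  refine ⟨x, ?_, rfl⟩
  rw [← interior_closedBall _ one_ne_zero]
  refine interior_maximal ?_ (φ.isOpen_inter_preimage isOpen_interior) ⟨hs hx, hy⟩
  rintro z ⟨hz, hzB⟩
  obtain ⟨w, hw, hwz⟩ := interior_subset hzB
  exact φ.injOn (hs hw) hz hwz ▸ hw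

end Balls

/-! ### Displacing unions of balls -/

section Displacement

variable [IsManifold I ∞ M] [T2Space M] [SigmaCompactSpace M]

/-- Given a piece family for `P` and the set of points moved by `g`, the points of `P` can be moved
by an isotopy into an open set which is displaced by `g`. -/
theorem exists_displaced_open (hr : r ≤ ∞) {g : M ≃ₘ^r⟮I, I⟯ M} {C : Set M}
    (hg : g ∈ DiffZero I r C) {P : Set M} {𝒪 : Set (Set M)} (hPI : P ⊆ I.interior M)
    (h𝒪 : IsPieceFamily P {x | g x ≠ x} 𝒪) :
    ∃ (A V : Set M) (h : M ≃ₘ^r⟮I, I⟯ M), IsClosed A ∧ A ⊆ I.interior M ∧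
      (𝒪.Finite → IsCompact A) ∧ IsotopicIn A h ∧ IsOpen V ∧ (∀ p ∈ P, h p ∈ V) ∧
      ∀ x ∈ V, g x ∉ V := by
  have : LocallyConnectedSpace M := locallyConnectedSpace_of_isManifold M I
  have : LocallyCompactSpace M := Manifold.locallyCompact_of_finiteDimensional I
  have : SecondCountableTopology H := I.secondCountableTopology
  have : SecondCountableTopology M := ChartedSpace.secondCountable_of_sigmaCompact H M
  have hNo : IsOpen (I.interior M) := I.isOpen_interior (n := ∞) (by simp)
  have hSo : IsOpen {x : M | g x ≠ x} := isOpen_ne_fun g.continuous continuous_id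
  have hOne : ∀ O ∈ 𝒪, O.Nonempty := fun O hO => (h𝒪.meets O hO).mono Set.inter_subset_left
  have hcount : Countable 𝒪 :=
    (Set.PairwiseDisjoint.countable_of_isOpen h𝒪.pairwiseDisjoint h𝒪.isOpen hOne).to_subtype
  -- In every piece choose an interior point moved by `g`, so that the images under `g` of the chosen
  -- points are again different from all chosen points.
  obtain ⟨s, hsT, hs⟩ := exists_selection_displaced
    (T := fun O : 𝒪 => O.1 ∩ {x | g x ≠ x} ∩ I.interior M) (fun O => by
      obtain ⟨x, hx, hxI⟩ := (dense_interior I M).inter_open_nonempty _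
        ((h𝒪.isOpen O O.2).inter hSo) (h𝒪.meets O O.2)
      have := neBot_nhdsNE_of_mem_diffZero hg hx.2
      exact infinite_of_mem_nhds x
        ((((h𝒪.isOpen O O.2).inter hSo).inter hNo).mem_nhds ⟨hx, hxI⟩))
    g.toEquiv fun O x hx => hx.1.2
  have hs_closed : IsClosed (⋃ O, ({s O} : Set M)) :=
    (h𝒪.locallyFinite_of_subset fun O => Set.singleton_subset_iff.2 (hsT O).1.1).isClosed_iUnion
      fun O => isClosed_singleton
  have hgs_closed : IsClosed (g '' ⋃ O, ({s O} : Set M)) := g.toHomeomorph.isClosedMap _ hs_closed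
  have hs_disj : Disjoint (⋃ O, ({s O} : Set M)) (g '' ⋃ O, ({s O} : Set M)) := by
    rw [Set.disjoint_left]
    rintro x hx ⟨y, hy, hyx⟩
    obtain ⟨O, rfl⟩ := Set.mem_iUnion.1 hx
    obtain ⟨O', rfl⟩ := Set.mem_iUnion.1 hy
    exact hs O' O hyx
  obtain ⟨V₁, V₂, hV₁, hV₂, hsV₁, hsV₂, hV₁₂⟩ := normal_separation hs_closed hgs_closed hs_disj
  set V := V₁ ∩ g ⁻¹' V₂ with hV
  have hVo : IsOpen V := hV₁.inter (hV₂.preimage g.continuous)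
  have hsV : ∀ O, s O ∈ V := fun O =>
    ⟨hsV₁ (Set.mem_iUnion.2 ⟨O, rfl⟩), hsV₂ ⟨s O, Set.mem_iUnion.2 ⟨O, rfl⟩, rfl⟩⟩
  have hmove : ∀ O : 𝒪, ∃ f : M ≃ₘ^r⟮I, I⟯ M, CompactlyIsotopicIn (O.1 ∩ I.interior M) f ∧
      ∀ x ∈ P ∩ O.1, f x ∈ V := fun O =>
    exists_move_finite hr ((h𝒪.isOpen O O.2).inter hNo) Set.inter_subset_right
      (isPreconnected_inter_interior (h𝒪.isOpen O O.2) (h𝒪.isPreconnected O O.2))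
      (h𝒪.inter_finite O O.2) (fun x hx => ⟨hx.2, hPI hx.1⟩) hVo
      ⟨s O, hsV O, (hsT O).1.1, (hsT O).2⟩
  choose f hf hfV using hmove
  choose A hA hAO hfA using hf
  have hAO' : ∀ O : 𝒪, A O ⊆ O.1 := fun O => (hAO O).trans Set.inter_subset_left
  have hlf : LocallyFinite A := h𝒪.locallyFinite_of_subset hAO'
  have hdisj : ∀ {O O' : 𝒪}, O ≠ O' → Disjoint O.1 O'.1 := fun {O O'} hne =>
    h𝒪.pairwiseDisjoint O.2 O'.2 fun heq => hne (Subtype.ext heq)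
  obtain ⟨h, hh, hhf⟩ := exists_glue_isotopicIn hfA (fun O => (hA O).isClosed) hlf
    fun O O' hne => (hdisj hne).mono (hAO' O) (hAO' O')
  refine ⟨⋃ O, A O, V, h, hlf.isClosed_iUnion fun O => (hA O).isClosed,
    Set.iUnion_subset fun O => (hAO O).trans Set.inter_subset_right, fun hfin => ?_, hh, hVo,
    fun p hp => ?_, fun x hx hgx => Set.disjoint_left.1 hV₁₂ hgx.1 hx.2⟩
  · have := hfin.to_subtype
    exact isCompact_iUnion hA
  · obtain ⟨O, hO, hpO⟩ := h𝒪.subset_sUnion hp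
    rw [hhf ⟨O, hO⟩ p fun O' hne hpO' =>
      Set.disjoint_left.1 (hdisj hne) (hAO' O' hpO') hpO]
    exact hfV ⟨O, hO⟩ p ⟨hp, hpO⟩

/-- Two diffeomorphisms supported in a discrete union of balls are supported in a subset `C` which
an ambient isotopy moves off its image under `g`, provided the centres of the balls admit a piece
family. -/
theorem exists_displacement_of_balls (hr : r ≤ ∞) {g : M ≃ₘ^r⟮I, I⟯ M} {C₀ : Set M}
    (hg : g ∈ DiffZero I r C₀) {𝓕 : Set (Set M)} (hball : ∀ B ∈ 𝓕, IsBall I r B)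
    (hdisc : IsDiscreteCollection 𝓕)
    (hpieces : ∀ P : Set M, (∀ K : Set M, IsCompact K → (P ∩ K).Finite) → (𝓕.Finite → P.Finite) →
      ∃ 𝒪, IsPieceFamily P {x | g x ≠ x} 𝒪)
    {a b : M ≃ₘ^r⟮I, I⟯ M} (ha : a ∈ DiffZero I r (interior (⋃₀ 𝓕))ᶜ)
    (hb : b ∈ DiffZero I r (interior (⋃₀ 𝓕))ᶜ) :
    ∃ (A C : Set M) (h : M ≃ₘ^r⟮I, I⟯ M), IsClosed A ∧ A ⊆ I.interior M ∧
      (𝓕.Finite → IsCompact A) ∧ IsotopicIn A h ∧ (∀ x ∉ C, a x = x) ∧ (∀ x ∉ C, b x = x) ∧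
      ∀ x ∈ C, ∀ y ∈ C, g (h x) ≠ h y := by
  have hcell : ∀ B : 𝓕, ∃ G : Set M, IsCell I r G ∧ G.Nonempty ∧ G ⊆ B ∧ interior B.1 ⊆ G :=
    fun B => (hball B B.2).exists_isCell hr
  choose G hG hGne hGB hBG using hcell
  choose c hc using hGne
  have hB_lf : LocallyFinite fun B : 𝓕 => B.1 := hdisc.locallyFinite fun B => subset_rfl
  have hdisj : ∀ {B B' : 𝓕} {x : M}, x ∈ B.1 → x ∈ B'.1 → B = B' := fun {B B' x} hx hx' =>
    Subtype.ext (hdisc.eq_of_mem B.2 B'.2 hx hx')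
  obtain ⟨𝒪, h𝒪⟩ := hpieces (Set.range c) (fun K hK => by
    refine ((hB_lf.finite_nonempty_inter_compact hK).image c).subset ?_
    rintro _ ⟨⟨B, rfl⟩, hBK⟩
    exact ⟨B, ⟨c B, hGB B (hc B), hBK⟩, rfl⟩) fun hfin => by
      have := hfin.to_subtype
      exact Set.finite_range c
  have hPI : Set.range c ⊆ I.interior M := by
    rintro _ ⟨B, rfl⟩
    exact (hball B B.2).subset_interior (hGB B (hc B))
  obtain ⟨A₁, V, h₁, hA₁, hA₁I, hA₁c, hh₁, hV, hPV, hgV⟩ := exists_displaced_open hr hg hPI h𝒪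
  -- `a` and `b` are the identity on the open neighbourhood `U` of the complement of the balls, so
  -- that they are supported in compact subsets of the interiors of the balls.
  obtain ⟨Ua, hUa, haU⟩ := eqOn_nhdsSet_of_mem_diffZero ha
  obtain ⟨Ub, hUb, hbU⟩ := eqOn_nhdsSet_of_mem_diffZero hb
  set U := interior (Ua ∩ Ub) with hU
  have hUsub : (interior (⋃₀ 𝓕))ᶜ ⊆ U := by
    rw [hU, subset_interior_iff_mem_nhdsSet]
    exact Filter.inter_mem hUa hUb
  have hKG : ∀ B : 𝓕, B.1 \ U ⊆ G B := by
    rintro B x ⟨hxB, hxU⟩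
    have hxD : x ∈ interior (⋃₀ 𝓕) := by
      by_contra hcon
      exact hxU (hUsub hcon)
    obtain ⟨W, hW, hWsub⟩ := hdisc x
    refine hBG B (mem_interior_iff_mem_nhds.2 ?_)
    filter_upwards [hW, mem_interior_iff_mem_nhds.1 hxD] with y hyW hyD
    obtain ⟨B', hB', hyB'⟩ := hyD
    have : B' = B.1 := hWsub ⟨hB', y, hyW, hyB'⟩ ⟨B.2, x, mem_of_mem_nhds hW, hxB⟩
    exact this ▸ hyB'
  have hshrink : ∀ B : 𝓕, ∃ k : M ≃ₘ^r⟮I, I⟯ M, CompactlyIsotopicIn (G B) k ∧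
      ∀ x ∈ B.1 \ U, k x ∈ h₁ ⁻¹' V := fun B =>
    (hG B).2 _ ((hball B B.2).isCompact.diff isOpen_interior) (hKG B) _ (hV.preimage h₁.continuous)
      ⟨c B, hPV _ ⟨B, rfl⟩, hc B⟩
  choose k hk hkV using hshrink
  choose A₂ hA₂ hA₂G hkA using hk
  have hA₂B : ∀ B, A₂ B ⊆ B.1 := fun B => (hA₂G B).trans (hGB B)
  have hA₂lf : LocallyFinite A₂ := hdisc.locallyFinite hA₂B
  obtain ⟨h₂, hh₂, hh₂k⟩ := exists_glue_isotopicIn hkA (fun B => (hA₂ B).isClosed) hA₂lf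
    fun B B' hne => Set.disjoint_left.2 fun x hx hx' => hne (hdisj (hA₂B B hx) (hA₂B B' hx'))
  have hCV : ∀ x ∈ ⋃₀ 𝓕 \ U, h₁ (h₂ x) ∈ V := by
    rintro x ⟨⟨B, hB, hxB⟩, hxU⟩
    rw [hh₂k ⟨B, hB⟩ x fun B' hne hxB' => hne (hdisj (hA₂B B' hxB') hxB)]
    exact hkV ⟨B, hB⟩ x ⟨hxB, hxU⟩
  have hout : ∀ x ∉ ⋃₀ 𝓕 \ U, x ∈ Ua ∩ Ub := by
    intro x hx
    by_contra hcon
    have hxU : x ∉ U := fun h => hcon (interior_subset h)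
    refine hx ⟨?_, hxU⟩
    by_contra hxD
    exact hxU (hUsub fun h => hxD (interior_subset h))
  refine ⟨A₁ ∪ ⋃ B, A₂ B, ⋃₀ 𝓕 \ U, h₁ * h₂,
    hA₁.union (hA₂lf.isClosed_iUnion fun B => (hA₂ B).isClosed),
    Set.union_subset hA₁I (Set.iUnion_subset fun B =>
      (hA₂B B).trans (hball B B.2).subset_interior), fun hfin => ?_,
    (hh₁.mono Set.subset_union_left).mul (hh₂.mono Set.subset_union_right),
    fun x hx => haU x (hout x hx).1, fun x hx => hbU x (hout x hx).2, fun x hx y hy heq => ?_⟩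
  · have := hfin.to_subtype
    exact (hA₁c (h𝒪.finite (Set.finite_range c))).union (isCompact_iUnion hA₂)
  · change g (h₁ (h₂ x)) = h₁ (h₂ y) at heq
    exact hgV _ (hCV x hx) (heq ▸ hCV y hy)

end Displacement

/-! ### Commutators supported in balls -/

section Commutators

/-- Diffeomorphisms with disjoint supports commute. -/
theorem commute_of_eqOn {C : Set M} {u b : M ≃ₘ^r⟮I, I⟯ M} (hu : ∀ x ∈ C, u x = x)
    (hb : ∀ x ∉ C, b x = x) : Commute u b := by
  refine Diffeomorph.ext fun x => ?_
  change u (b x) = b (u x)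
  by_cases hx : x ∈ C
  · have hbx : b x ∈ C := by
      by_contra hcon
      exact hcon ((b.injective (hb _ hcon)).symm ▸ hx)
    rw [hu x hx, hu _ hbx]
  · have hux : u x ∉ C := fun hcon => hx (u.injective (hu _ hcon) ▸ hcon)
    rw [hb x hx, hb _ hux]

/-- If `a` and `b` are supported in `C` and `g` displaces the image of `C` under `h`, then `[a, b]` is
a product of four conjugates of `g` and `g⁻¹` in any subgroup containing `a`, `b`, `g` and `h`. -/
theorem exists_conj_list_of_displacement {G : Subgroup (M ≃ₘ^r⟮I, I⟯ M)} {g a b h : G} {C : Set M}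
    (ha : ∀ x ∉ C, a.1 x = x) (hb : ∀ x ∉ C, b.1 x = x)
    (hC : ∀ x ∈ C, ∀ y ∈ C, g.1 (h.1 x) ≠ h.1 y) :
    ∃ l : List G, (∀ s ∈ l, s ∈ {x : G | ∃ h : G, x = h * g * h⁻¹ ∨ x = h * g⁻¹ * h⁻¹}) ∧
      l.prod = a * b * a⁻¹ * b⁻¹ ∧ l.length = 4 := by
  refine exists_conj_list_of_commute (h := h⁻¹) ?_
  rw [inv_inv]
  refine Subtype.ext (commute_of_eqOn (C := C) (u := (h⁻¹ * g * h * a⁻¹ * (h⁻¹ * g * h)⁻¹ : G).1)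
    (fun x hx => ?_) hb).eq
  set γ : M ≃ₘ^r⟮I, I⟯ M := (h⁻¹ * g * h : G).1 with hγ
  change γ (a.1.symm (γ.symm x)) = x
  have hfix : a.1 (γ.symm x) = γ.symm x := by
    refine ha _ fun hy => hC _ hy x hx ?_
    have h1 : γ (γ.symm x) = x := γ.apply_symm_apply x
    have h2 : h.1.symm (g.1 (h.1 (γ.symm x))) = x := h1
    rw [← h.1.apply_symm_apply (g.1 (h.1 (γ.symm x))), h2]
  have hfix' : a.1.symm (γ.symm x) = γ.symm x := by
    rw [← hfix, a.1.symm_apply_apply, hfix]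
  rw [hfix', γ.apply_symm_apply]

/-- The estimate between the two norms on a subgroup `G`, given the displacement of balls by
elements of `G`. -/
theorem conjNorm_le_four_mul {G : Subgroup (M ≃ₘ^r⟮I, I⟯ M)} {𝓑 : Set (Set M)} {g : G}
    (h : ∀ D ∈ 𝓑, ∀ a ∈ DiffZero I r (interior D)ᶜ, ∀ b ∈ DiffZero I r (interior D)ᶜ,
      a ∈ G ∧ b ∈ G ∧ ∃ (C : Set M) (h : G), (∀ x ∉ C, a x = x) ∧ (∀ x ∉ C, b x = x) ∧
        ∀ x ∈ C, ∀ y ∈ C, g.1 (h.1 x) ≠ h.1 y) (f : G) :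
    conjNorm g f ≤ 4 * wordNorm (ballCommutators G 𝓑) f := by
  refine wordNorm_le_mul (k := 4) (by norm_num) ?_ f
  rintro f ⟨D, hD, a, ha, b, hb, hf⟩
  obtain ⟨haG, hbG, C, k, haC, hbC, hC⟩ := h D hD a ha b hb
  obtain ⟨l, hl, hprod, hlen⟩ := exists_conj_list_of_displacement (a := ⟨a, haG⟩) (b := ⟨b, hbG⟩)
    haC hbC hC
  exact ⟨l, hl, hprod.trans (Subtype.ext hf.symm), hlen⟩

end Commutators

end BallNorm

theorem lemma6p5 (n : ℕ) {H : Type*} [TopologicalSpace H]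
    (I : ModelWithCorners ℝ (EuclideanSpace ℝ (Fin n)) H) (hI : BallNorm.IsBoundaryModel I)
    {M : Type*} [TopologicalSpace M] [ChartedSpace H M] [IsManifold I ∞ M]
    [T2Space M] [SigmaCompactSpace M]
    (r : WithTop ℕ∞) (hr : 1 ≤ r) (hr' : r ≤ ∞)
    (g : M ≃ₘ^r⟮I, I⟯ M) (hg : g ∈ BallNorm.DiffZero I r (I.boundary M))
    (hg_nontrivial : BallNorm.ComponentwiseNontrivial g) :
    (∀ f : BallNorm.DiffZero I r (I.boundary M),
      BallNorm.conjNorm ⟨g, hg⟩ f ≤ 4 * BallNorm.clbf (BallNorm.DiffZero I r (I.boundary M)) f) ∧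
    (∀ hgc : g ∈ BallNorm.DiffCompactZero I r (I.boundary M),
      ∀ f : BallNorm.DiffCompactZero I r (I.boundary M),
        BallNorm.conjNorm ⟨g, hgc⟩ f ≤
          4 * BallNorm.clbf (BallNorm.DiffCompactZero I r (I.boundary M)) f) ∧
    (BallNorm.ComponentwiseEndNontrivial g →
      ∀ f : BallNorm.DiffZero I r (I.boundary M),
        BallNorm.conjNorm ⟨g, hg⟩ f ≤
          4 * BallNorm.clbd (BallNorm.DiffZero I r (I.boundary M)) f) := by
  open BallNorm in
  have : LocallyConnectedSpace M := locallyConnectedSpace_of_isManifold M I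
  have : LocallyCompactSpace M := Manifold.locallyCompact_of_finiteDimensional I
  have hbd : ∀ 𝓕 : Set (Set M), (∀ B ∈ 𝓕, IsBall I r B) →
      I.boundary M ⊆ (interior (⋃₀ 𝓕))ᶜ := fun 𝓕 hball => by
    rw [← I.compl_interior, Set.compl_subset_compl]
    exact interior_subset.trans (Set.sUnion_subset fun B hB => (hball B hB).subset_interior)
  have hdisc : ∀ 𝓕 : Set (Set M), (∀ B ∈ 𝓕, IsBall I r B) → 𝓕.Finite →
      𝓕.PairwiseDisjoint id → IsDiscreteCollection 𝓕 := fun 𝓕 hball hfin hdisj =>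
    isDiscreteCollection_of_finite hfin (fun B hB => (hball B hB).isCompact.isClosed) hdisj
  refine ⟨conjNorm_le_four_mul ?_, fun hgc => conjNorm_le_four_mul ?_,
    fun hend => conjNorm_le_four_mul ?_⟩
  · rintro _ ⟨𝓕, hball, hfin, hdisj, rfl⟩ a ha b hb
    obtain ⟨A, C, h, hA, hAI, -, hh, haC, hbC, hC⟩ := exists_displacement_of_balls hr' hg hball
      (hdisc 𝓕 hball hfin hdisj) (fun P _ hP =>
        exists_isPieceFamily_of_componentwiseNontrivial hg_nontrivial (hP hfin)) ha hb
    exact ⟨diffZero_mono (hbd 𝓕 hball) ha, diffZero_mono (hbd 𝓕 hball) hb, C,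
      ⟨h, hh.mem_diffZero hA hAI⟩, haC, hbC, hC⟩
  · rintro _ ⟨𝓕, hball, hfin, hdisj, rfl⟩ a ha b hb
    obtain ⟨A, C, h, -, hAI, hA, hh, haC, hbC, hC⟩ := exists_displacement_of_balls hr' hg hball
      (hdisc 𝓕 hball hfin hdisj) (fun P _ hP =>
        exists_isPieceFamily_of_componentwiseNontrivial hg_nontrivial (hP hfin)) ha hb
    have hle := diffZero_le_diffCompactZero (I := I) (r := r) (hbd 𝓕 hball)
      (hfin.isCompact_sUnion fun B hB => (hball B hB).isCompact)
      (by rw [compl_compl]; exact interior_subset)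
    exact ⟨hle ha, hle hb, C, ⟨h, hh.mem_diffCompactZero (hA hfin) hAI⟩, haC, hbC, hC⟩
  · rintro _ ⟨𝓕, hball, hdisc', rfl⟩ a ha b hb
    obtain ⟨A, C, h, hA, hAI, -, hh, haC, hbC, hC⟩ := exists_displacement_of_balls hr' hg hball
      hdisc' (fun P hP _ => exists_isPieceFamily_of_componentwiseEndNontrivial hend hP) ha hb
    exact ⟨diffZero_mono (hbd 𝓕 hball) ha, diffZero_mono (hbd 𝓕 hball) hb, C,
      ⟨h, hh.mem_diffZero hA hAI⟩, haC, hbC, hC⟩
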